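/- Let $h>0$ and let $g:[0,\infty)\to[0,\infty)$ be Lipschitz continuous with constant $L_g>1$. For $c\in\mathbb R$ put $E_c(\lambda)=-\lambda^2+c\lambda+1-L_ge^{-\lambda ch}$ and $$c(L_g)=\inf\{c>0:\ E_c(\lambda_0)\ge 0\ \text{for some}\ \lambda_0\in\mathbb R\}.$$ Let $c\ge c(L_g)$, let $\lambda_1(c)\le\lambda_2(c)$ be the real zeros of $E_c$ (which may coincide), fix $\lambda_c\in[\lambda_1(c),\lambda_2(c)]$ and let $\xi_c(z)=e^{-\lambda_cz}$. Set $$m=2\lambda_c-c,\qquad p=\lambda_c^2-c\lambda_c-1,\qquad q=L_ge^{-\lambda_cch},\qquad d=-ch.$$ Let $v,\psi:[-h,\infty)\times\mathbb R\to[0,\infty)$ be solutions of $$v_t(t,z)=v_{zz}(t,z)-cv_z(t,z)-v(t,z)+g(v(t-h,z-ch)),\qquad t>0,\ z\in\mathbb R,$$ such that $$u_0(s,z):=\xi_c(z)\,|v(s,z)-\psi(s,z)|,\quad s\in[-h,0],\qquad\text{belongs to } C([-h,0],L^1(\mathbb R)).$$ Here and below a solution is a continuous function on $[-h,\infty)\times\mathbb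 R$ that satisfies the equation on $(0,\infty)\times\mathbb R$ in the sense of distributions (in particular, classical solutions are covered). Say that a function $w$ has Gaussian growth if for every $T$ there are $C,a$ with $|w(t,z)|\le Ce^{az^2}$ for all $t\in[-h,T]$, $z\in\mathbb R$; assume that $v-\psi$ has Gaussian growth (for instance, that $v$ and $\psi$ are bounded). Then: 1. If $u$ is a solution with Gaussian growth of the linear delayed equation $$u_t(t,x)=u_{xx}(t,x)+mu_x(t,x)+pu(t,x)+qu(t-h,x+d),\qquad t>0,\ x\in\mathbb R,$$ with $u(s,\cdot)=u_0(s,\cdot)$ for $s\in[-h,0]$, then $$\xi_c(z)\,|v(t,z)-\psi(t,z)|\le u(t,z)\qquad\text{for all } t\ge-h,\ z\in\mathbb R.$$ 2. The equation $\gamma-p=qe^{-h\gamma}$ has exactly one real solution $\gamma$, it satisfies $\gamma\le0$, and $$|v(t,z)-\psi(t,z)|\le A_0\,e^{\lambda_cz}\,\frac{e^{\gamma t}}{\sqrt t}\qquad\text{for all } t>\tfrac h2,\ z\in\mathbb R,$$ where $A_0=\tfrac12\Big(\sup_{s\in[-h,0]}\|u_0(s,\cdot)\|_{L^1(\mathbb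 R)}\Big)\sqrt{1+h(\gamma-p)}$. 3. Consequently, for every $N\in\mathbb R$, $v(t,z)-\psi(t,z)\to0$ as $t\to\infty$ uniformly for $z\in(-\infty,N]$ (stability of the leading edge). -/

import Mathlib

open Set Filter Topology MeasureTheory
open scoped NNReal ContDiff

noncomputable section

/-- The function `E_c(x) = -x² + c x + 1 - L e^{-x c h}`. -/
def charE (h L c x : ℝ) : ℝ :=
  -x ^ 2 + c * x + 1 - L * Real.exp (-(x * c * h))

/-- `c(L) = inf {c > 0 : E_c(x) ≥ 0 for some real x}`. -/
def criticalSpeed (h L : ℝ) : ℝ :=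
  sInf {c : ℝ | 0 < c ∧ ∃ x : ℝ, 0 ≤ charE h L c x}

/-- The smaller real zero of `E_c`. -/
def lambdaOne (h L c : ℝ) : ℝ := sInf {x : ℝ | charE h L c x = 0}

/-- The larger real zero of `E_c`. -/
def lambdaTwo (h L c : ℝ) : ℝ := sSup {x : ℝ | charE h L c x = 0}

/-- `w` (a function of time `t` and space `z`, relevant for `t ≥ -h`) is continuous on
`[-h, ∞) × ℝ` and solves
`w_t(t,z) = w_zz(t,z) + m w_z(t,z) + p w(t,z) + f (w(t-h, z+d))` for `t > 0`, `z ∈ ℝ`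
in the sense of distributions. In particular every classical solution qualifies. -/
structure IsDelayedSolution (h m p d : ℝ) (f : ℝ → ℝ) (w : ℝ → ℝ → ℝ) : Prop where
  continuousOn : ContinuousOn (Function.uncurry w) (Ici (-h) ×ˢ univ)
  weak_eq : ∀ φ : ℝ → ℝ → ℝ,
    ContDiff ℝ ∞ (Function.uncurry φ) →
    HasCompactSupport (Function.uncurry φ) →
    tsupport (Function.uncurry φ) ⊆ Ioi 0 ×ˢ univ →
    ∫ t in Ioi (0 : ℝ), ∫ z : ℝ,
      (w t z * (-(deriv (fun τ => φ τ z) t) - iteratedDeriv 2 (φ t) z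
          + m * deriv (φ t) z - p * φ t z)
        - f (w (t - h) (z + d)) * φ t z) = 0

/-- Nonnegative solutions of `v_t = v_zz - c v_z - v + g(v(t-h, z-ch))`, `t > 0`, where `g` is
a function on `[0, ∞)`. -/
structure IsWaveSolution (h c : ℝ) (g : ℝ → ℝ) (v : ℝ → ℝ → ℝ) : Prop where
  nonneg : ∀ t, -h ≤ t → ∀ z, 0 ≤ v t z
  solves : IsDelayedSolution h (-c) (-1) (-(c * h)) g v

/-- Solutions of `u_t = u_xx + m u_x + p u + q u(t-h, x+d)`, `t > 0`. -/
def IsLinearSolution (h m p q d : ℝ) (u : ℝ → ℝ → ℝ) : Prop :=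
  IsDelayedSolution h m p d (fun y => q * y) u

/-- Growth at most like a Gaussian exponential `C e^{a z²}`, uniformly on bounded time
intervals: the usual uniqueness class of parabolic equations on the line. -/
def HasGaussianGrowth (h : ℝ) (w : ℝ → ℝ → ℝ) : Prop :=
  ∀ T : ℝ, ∃ C a : ℝ, ∀ t ∈ Icc (-h) T, ∀ z : ℝ, |w t z| ≤ C * Real.exp (a * z ^ 2)

/-- The restriction of `f` to times in `[-h, 0]` belongs to `C([-h, 0], L¹(ℝ))`. -/
def MemCL1 (h : ℝ) (f : ℝ → ℝ → ℝ) : Prop :=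
  ∃ U : C(Icc (-h) 0, Lp ℝ 1 (volume : Measure ℝ)),
    ∀ s : Icc (-h) 0, (U s : ℝ → ℝ) =ᵐ[volume] f s

/-- `sup_{s ∈ [-h, 0]} ‖f(s, ·)‖_{L¹}`. -/
def supL1 (h : ℝ) (f : ℝ → ℝ → ℝ) : ℝ :=
  ⨆ s : Icc (-h) 0, ∫ z : ℝ, |f s z|

/-- The weight `ξ(z) = e^{-lam z}`. -/
def weight (lam z : ℝ) : ℝ := Real.exp (-(lam * z))

/-- `ξ(z) |v(t,z) - ψ(t,z)|`. -/
def weightedDiff (lam : ℝ) (v ψ : ℝ → ℝ → ℝ) (t z : ℝ) : ℝ :=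
  weight lam z * |v t z - ψ t z|

/-- `m(lam) = 2 lam - c`. -/
def coefM (c lam : ℝ) : ℝ := 2 * lam - c

/-- `p(lam) = lam² - c lam - 1`. -/
def coefP (c lam : ℝ) : ℝ := lam ^ 2 - c * lam - 1

/-- `q(lam) = L e^{-lam c h}`. -/
def coefQ (h L c lam : ℝ) : ℝ := L * Real.exp (-(lam * c * h))

end

/-!
The idea is to replace the differential equation by Duhamel's formula and to work with positive
Gaussian averages only.

*From weak solutions to Duhamel's formula.* The equation is tested with a time cutoff, a space
cutoff and the backward heat kernel with its pole slightly after the final time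
(`heatKernel_cutoff_identity`). The lemma of du Bois-Reymond removes the time cutoff; Gaussian
growth allows the space cutoff to be removed and the pole to be moved to the final time, provided
the time interval is short compared with the reciprocal of the growth rate
(`HasCutoffIdentity.duhamel`). The weight `e^{-lam z}` conjugates the heat semigroup with
coefficients `(-c, -1)` to the one with coefficients `(m, p)` (`weight_mul_heatOp`), so `W`, the
weighted difference of the two solutions, satisfies Duhamel's formula with a source bounded by
`q |W(t - h, z + d)|`, by the Lipschitz bound on `g`. Comparison with a solution `u` of the linear
equation then follows by induction over short time steps (`IsMildSolution.abs_le`).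

*Decay.* The same formula controls the Gaussian averages of `|W|`. The peak of the heat kernel is
the superposition `(4 π s)^{-1/2} = π⁻¹ ∫_0^∞ e^{-ζ² s} dζ`, and the averages inherit a bound
`M π⁻¹ ∫_0^∞ e^{-ζ² s} β ζ t dζ` for every family of supersolutions `β ζ ·` of the scalar delay
equations `β' = (p - ζ²) β + q β(t - h)` that starts above `1`
(`enorm_le_of_frequency_supersolution`). At `s = 0` this bounds `|W|` itself. With `κ = γ - p`,

* for `t ≥ h` the supersolution is `e^{γ t} (1 + a ζ²)^{-t / h}` with `a = h / (1 + h κ)`, and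
  Bernoulli's inequality together with `∫_0^∞ (1 + b ζ²)⁻¹ dζ = π / (2 √b)` gives exactly the stated
  constant;
* for `0 < t ≤ h` the supersolution is `e^{(p - ζ²) t} + κ / (ζ² + κ) e^{γ t}`, and an elementary
  inequality suffices.

The hypotheses on the speed enter through `charE_nonneg_of_mem_Icc`: the characteristic function is
concave, hence nonnegative between its zeros, which says that `p + q ≤ 0` and yields `γ ≤ 0`.
-/

/-! ### The fundamental lemma of the calculus of variations -/

/-- A smooth function supported in `[a, b]` whose integral vanishes is the derivative of a smooth
function supported in `[a, b]`. -/
theorem exists_primitive_of_integral_eq_zero {a b : ℝ} (hab : a ≤ b) {f : ℝ → ℝ}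
    (hf : ContDiff ℝ ∞ f) (hsupp : ∀ t, t ∉ Icc a b → f t = 0) (hint : ∫ t, f t = 0) :
    ∃ θ : ℝ → ℝ, ContDiff ℝ ∞ θ ∧ (∀ t, t ∉ Icc a b → θ t = 0) ∧ ∀ t, HasDerivAt θ (f t) t := by
  have hcont : Continuous f := hf.continuous
  have hderiv : ∀ t, HasDerivAt (fun t => ∫ s in a..t, f s) (f t) t := fun t =>
    intervalIntegral.integral_hasDerivAt_right (hcont.intervalIntegrable _ _)
      (hcont.stronglyMeasurableAtFilter _ _) hcont.continuousAt
  have hint' : ∫ t in a..b, f t = 0 := by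
    rw [intervalIntegral.integral_of_le hab, ← integral_Icc_eq_integral_Ioc,
      setIntegral_eq_integral_of_forall_compl_eq_zero hsupp, hint]
  refine ⟨fun t => ∫ s in a..t, f s, ?_, ?_, hderiv⟩
  · rw [contDiff_infty_iff_deriv]
    refine ⟨fun t => (hderiv t).differentiableAt, ?_⟩
    rwa [funext fun t => (hderiv t).deriv]
  · intro t ht
    have hzero : ∀ u v : ℝ, (∀ s ∈ Ioo (min u v) (max u v), f s = 0) →
        ∫ s in u..v, f s = 0 := by
      intro u v huv
      have : ∀ᵐ s, s ∈ uIoc u v → f s = 0 := by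
        have hne : ∀ᵐ s : ℝ, s ≠ max u v := by
          simp [ae_iff]
        filter_upwards [hne] with s hs hsu
        exact huv s ⟨hsu.1, lt_of_le_of_ne hsu.2 hs⟩
      rw [intervalIntegral.integral_congr_ae (g := fun _ => (0 : ℝ)) this]
      simp
    rcases lt_or_ge t a with hta | hta
    · refine hzero a t fun s hs => hsupp s fun hs' => ?_
      rw [max_eq_left hta.le] at hs
      exact absurd hs'.1 (not_le.2 hs.2)
    · have htb : b < t := by
        by_contra hcon
        exact ht ⟨hta, not_lt.1 hcon⟩
      have h1 := intervalIntegral.integral_add_adjacent_intervals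
        (hcont.intervalIntegrable (μ := volume) a b) (hcont.intervalIntegrable b t)
      change ∫ s in a..t, f s = 0
      rw [← h1, hint', zero_add]
      refine hzero b t fun s hs => hsupp s fun hs' => ?_
      rw [min_eq_left htb.le] at hs
      exact absurd hs'.2 (not_le.2 hs.1)

/-- A compact subset of an open interval is contained in a closed subinterval. -/
theorem exists_Icc_of_isCompact_subset_Ioo {a b : ℝ} (hab : a < b) {K : Set ℝ} (hK : IsCompact K)
    (hsub : K ⊆ Ioo a b) : ∃ a' b', a < a' ∧ a' ≤ b' ∧ b' < b ∧ K ⊆ Icc a' b' := by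
  rcases K.eq_empty_or_nonempty with rfl | hne
  · exact ⟨(a + b) / 2, (a + b) / 2, by linarith, le_rfl, by linarith, empty_subset _⟩
  · have h1 := hK.sInf_mem hne
    have h2 := hK.sSup_mem hne
    exact ⟨sInf K, sSup K, (hsub h1).1, csInf_le hK.bddBelow h2, (hsub h2).2, fun x hx =>
      ⟨csInf_le hK.bddBelow hx, le_csSup hK.bddAbove hx⟩⟩

/-- A continuous function whose distributional derivative vanishes on an open interval is constant
on its closure. -/
theorem eq_of_integral_deriv_mul_eq_zero {a b : ℝ} {H : ℝ → ℝ} (hH : Continuous H)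
    (hw : ∀ θ : ℝ → ℝ, ContDiff ℝ ∞ θ → HasCompactSupport θ → tsupport θ ⊆ Ioo a b →
      ∫ t, deriv θ t * H t = 0) {t : ℝ} (ht : t ∈ Icc a b) : H t = H a := by
  rcases ht.1.eq_or_lt with rfl | hat
  · rfl
  have hab : a < b := hat.trans_le ht.2
  let ρ : ContDiffBump ((a + b) / 2) :=
    ⟨(b - a) / 8, (b - a) / 4, by linarith, by linarith⟩
  have hρK : tsupport (ρ.normed volume) ⊆ Ioo a b := by
    rw [ρ.tsupport_normed_eq, Real.closedBall_eq_Icc]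
    intro x hx
    simp only [ρ] at hx
    exact ⟨by linarith [hx.1], by linarith [hx.2]⟩
  set k : ℝ := ∫ t, ρ.normed volume t * H t
  have hae : ∀ᵐ t, t ∈ Ioo a b → H t - k = 0 := by
    refine isOpen_Ioo.ae_eq_zero_of_integral_contDiff_smul_eq_zero
      ((hH.sub continuous_const).locallyIntegrable.locallyIntegrableOn _) ?_
    intro g hg hgc hgs
    obtain ⟨a', b', ha', hab', hb', hKs⟩ := exists_Icc_of_isCompact_subset_Ioo hab
      (hgc.isCompact.union ρ.hasCompactSupport_normed.isCompact) (union_subset hgs hρK)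
    have hg0 : ∀ t, t ∉ Icc a' b' → g t = 0 := fun t ht =>
      image_eq_zero_of_notMem_tsupport fun h => ht (hKs (Or.inl h))
    have hρ0 : ∀ t, t ∉ Icc a' b' → ρ.normed volume t = 0 := fun t ht =>
      image_eq_zero_of_notMem_tsupport fun h => ht (hKs (Or.inr h))
    have hρd : ContDiff ℝ ∞ (ρ.normed volume) := ρ.contDiff_normed (n := ⊤)
    have hgi : Integrable g := hg.continuous.integrable_of_hasCompactSupport hgc
    have hρi : Integrable (ρ.normed volume) := ρ.integrable_normed
    obtain ⟨θ, hθd, hθ0, hθ'⟩ := exists_primitive_of_integral_eq_zero hab'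
      (f := fun t => g t - (∫ s, g s) * ρ.normed volume t)
      (hg.sub (contDiff_const.mul hρd)) (fun t ht => by simp [hg0 t ht, hρ0 t ht])
      (by rw [integral_sub hgi (hρi.const_mul _), integral_const_mul, ρ.integral_normed]; ring)
    have hθs : tsupport θ ⊆ Icc a' b' := closure_minimal
      (fun t ht => by_contra fun h => ht (hθ0 t h)) isClosed_Icc
    have hθc : HasCompactSupport θ := isCompact_Icc.of_isClosed_subset (isClosed_tsupport _) hθs
    have h0 := hw θ hθd hθc (hθs.trans (Icc_subset_Ioo ha' hb'))
    have hgH : Integrable fun t => g t * H t :=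
      (hg.continuous.mul hH).integrable_of_hasCompactSupport hgc.mul_right
    have hρH : Integrable fun t => ρ.normed volume t * H t :=
      (hρd.continuous.mul hH).integrable_of_hasCompactSupport
        (ρ.hasCompactSupport_normed (μ := volume)).mul_right
    have h1 : ∫ t, deriv θ t * H t = (∫ t, g t * H t) - (∫ s, g s) * k := by
      rw [← integral_const_mul, ← integral_sub hgH (hρH.const_mul _)]
      refine integral_congr_ae (ae_of_all _ fun t => ?_)
      simp only [(hθ' t).deriv]
      ring
    have h2 : ∫ t, g t • (H t - k) = (∫ t, g t * H t) - (∫ s, g s) * k := by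
      rw [← integral_mul_const, ← integral_sub hgH (hgi.mul_const _)]
      refine integral_congr_ae (ae_of_all _ fun t => ?_)
      simp only [smul_eq_mul]
      ring
    rw [h2, ← h1, h0]
  have hae' : ∀ᵐ t ∂(volume.restrict (Ioo a b)), H t = k := by
    rw [ae_restrict_iff' measurableSet_Ioo]
    filter_upwards [hae] with t ht h
    linarith [ht h]
  have heq : EqOn H (fun _ => k) (Ioo a b) :=
    Measure.eqOn_open_of_ae_eq hae' isOpen_Ioo hH.continuousOn continuousOn_const
  have heq' : EqOn H (fun _ => k) (Icc a b) := by
    have := heq.closure hH continuous_const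
    rwa [closure_Ioo hab.ne] at this
  rw [heq' ht, heq' (left_mem_Icc.2 hab.le)]

/-- The lemma of du Bois-Reymond with a source: if `I' = -A` on `(a, b)` in the sense of
distributions and both functions are continuous, then `I` is a primitive of `-A`. -/
theorem sub_eq_integral_of_weak_deriv {a b : ℝ} (hab : a ≤ b) {I A : ℝ → ℝ}
    (hI : ContinuousOn I (Icc a b)) (hA : ContinuousOn A (Icc a b))
    (hw : ∀ θ : ℝ → ℝ, ContDiff ℝ ∞ θ → HasCompactSupport θ → tsupport θ ⊆ Ioo a b →
      ∫ t, (-(deriv θ t) * I t + θ t * A t) = 0) :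
    I b - I a = -∫ t in a..b, A t := by
  let I' := IccExtend hab ((Icc a b).domRestrict I)
  let A' := IccExtend hab ((Icc a b).domRestrict A)
  have hI'c : Continuous I' := (continuousOn_iff_continuous_domRestrict.1 hI).Icc_extend'
  have hA'c : Continuous A' := (continuousOn_iff_continuous_domRestrict.1 hA).Icc_extend'
  have hI' : ∀ t ∈ Icc a b, I' t = I t := fun t ht => by
    simp [I', IccExtend_of_mem hab _ ht, domRestrict]
  have hA' : ∀ t ∈ Icc a b, A' t = A t := fun t ht => by
    simp [A', IccExtend_of_mem hab _ ht, domRestrict]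
  have hP : ∀ t, HasDerivAt (fun t => ∫ s in a..t, A' s) (A' t) t := fun t =>
    intervalIntegral.integral_hasDerivAt_right (hA'c.intervalIntegrable _ _)
      (hA'c.stronglyMeasurableAtFilter _ _) hA'c.continuousAt
  have hPc : Continuous fun t => ∫ s in a..t, A' s :=
    continuous_iff_continuousAt.2 fun t => (hP t).continuousAt
  have key := eq_of_integral_deriv_mul_eq_zero (a := a) (b := b)
    (H := fun t => I' t + ∫ s in a..t, A' s) (hI'c.add hPc) ?_ (right_mem_Icc.2 hab)
  · simp only [intervalIntegral.integral_same, add_zero] at key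
    rw [hI' _ (left_mem_Icc.2 hab), hI' _ (right_mem_Icc.2 hab)] at key
    have : ∫ t in a..b, A' t = ∫ t in a..b, A t := by
      refine intervalIntegral.integral_congr fun t ht => hA' t ?_
      rwa [uIcc_of_le hab] at ht
    linarith
  · intro θ hθ hθc hθs
    have hθ'c : HasCompactSupport (deriv θ) := hθc.deriv
    have hθ'cont : Continuous (deriv θ) := hθ.continuous_deriv (by simp)
    have i1 : Integrable fun t => deriv θ t * I' t :=
      (hθ'cont.mul hI'c).integrable_of_hasCompactSupport hθ'c.mul_right
    have i2 : Integrable fun t => deriv θ t * ∫ s in a..t, A' s :=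
      (hθ'cont.mul hPc).integrable_of_hasCompactSupport hθ'c.mul_right
    have i3 : Integrable fun t => θ t * A' t :=
      (hθ.continuous.mul hA'c).integrable_of_hasCompactSupport hθc.mul_right
    have i4 : Integrable fun t => θ t * ∫ s in a..t, A' s :=
      (hθ.continuous.mul hPc).integrable_of_hasCompactSupport hθc.mul_right
    have hparts : ∫ t, θ t * A' t = -∫ t, deriv θ t * ∫ s in a..t, A' s :=
      integral_mul_deriv_eq_deriv_mul_of_integrable
        (fun t _ => (hθ.differentiable (by simp) t).hasDerivAt) (fun t _ => hP t) i3 i2 i4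
    have h0 := hw θ hθ hθc hθs
    have h1 : ∫ t, (-(deriv θ t) * I t + θ t * A t)
        = ∫ t, (-(deriv θ t * I' t) + θ t * A' t) := by
      refine integral_congr_ae (ae_of_all _ fun t => ?_)
      by_cases ht : t ∈ Icc a b
      · simp only [hI' t ht, hA' t ht]; ring
      · have hts : t ∉ tsupport θ := fun h => ht (Ioo_subset_Icc_self (hθs h))
        have e1 : θ t = 0 := image_eq_zero_of_notMem_tsupport hts
        have e2 : deriv θ t = 0 :=
          image_eq_zero_of_notMem_tsupport fun h => hts (tsupport_deriv_subset h)
        simp [e1, e2]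
    have h2 : ∫ t, (-(deriv θ t * I' t) + θ t * A' t)
        = -(∫ t, deriv θ t * I' t) + ∫ t, θ t * A' t := by
      rw [← integral_neg]
      exact integral_add i1.neg i3
    rw [h1, h2] at h0
    simp only [mul_add]
    rw [integral_add i1 i2]
    linarith

/-! ### The heat kernel as a test function -/

/-- The weak form of `w_t = w_zz + m w_z + p w + F` on `(0, ∞) × ℝ`. -/
def IsWeakSolution (m p : ℝ) (w F : ℝ → ℝ → ℝ) : Prop :=
  ∀ φ : ℝ → ℝ → ℝ,
    ContDiff ℝ ∞ (Function.uncurry φ) →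
    HasCompactSupport (Function.uncurry φ) →
    tsupport (Function.uncurry φ) ⊆ Ioi 0 ×ˢ univ →
    ∫ t in Ioi (0 : ℝ), ∫ z : ℝ,
      (w t z * (-(deriv (fun τ => φ τ z) t) - iteratedDeriv 2 (φ t) z
          + m * deriv (φ t) z - p * φ t z) - F t z * φ t z) = 0

/-- The density at `z` of the Gaussian with mean `x + m τ` and variance `2 τ`, times `e^{p τ}`,
for `τ > 0`: the fundamental solution of `w_t = w_zz + m w_z + p w`. It is written as a single
exponential, which makes its derivatives immediate. -/
noncomputable def heatKernel (m p x τ z : ℝ) : ℝ :=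
  Real.exp (p * τ - Real.log (4 * Real.pi * τ) / 2 - (z - x - m * τ) ^ 2 / (4 * τ))

/-- The space derivative of `heatKernel`. -/
noncomputable def heatKernelDeriv (m p x τ z : ℝ) : ℝ :=
  -(z - x - m * τ) / (2 * τ) * heatKernel m p x τ z

theorem hasDerivAt_heatKernel_space (m p x τ z : ℝ) :
    HasDerivAt (heatKernel m p x τ) (heatKernelDeriv m p x τ z) z := by
  have h1 : HasDerivAt (fun z : ℝ => p * τ - Real.log (4 * Real.pi * τ) / 2
      - (z - x - m * τ) ^ 2 / (4 * τ)) (-((2 * (z - x - m * τ)) / (4 * τ))) z := by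
    have := (((((hasDerivAt_id z).sub_const x).sub_const (m * τ)).pow 2).div_const
      (4 * τ)).const_sub (p * τ - Real.log (4 * Real.pi * τ) / 2)
    simpa using this
  refine HasDerivAt.congr_deriv (f := heatKernel m p x τ) h1.exp ?_
  rw [heatKernelDeriv, heatKernel, mul_comm (Real.exp _)]
  congr 1
  rw [neg_div, show 4 * τ = 2 * (2 * τ) by ring, mul_div_mul_left _ _ two_ne_zero]

theorem hasDerivAt_heatKernelDeriv_space (m p x z : ℝ) {τ : ℝ} (hτ : 0 < τ) :
    HasDerivAt (heatKernelDeriv m p x τ)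
      (((z - x - m * τ) ^ 2 / (4 * τ ^ 2) - 1 / (2 * τ)) * heatKernel m p x τ z) z := by
  have h1 : HasDerivAt (fun z : ℝ => -(z - x - m * τ) / (2 * τ)) (-1 / (2 * τ)) z :=
    ((((hasDerivAt_id z).sub_const x).sub_const (m * τ)).neg).div_const (2 * τ)
  refine (h1.mul (hasDerivAt_heatKernel_space m p x τ z)).congr_deriv ?_
  rw [heatKernelDeriv]
  field_simp
  ring

theorem hasDerivAt_heatKernel_time (m p x z : ℝ) {τ : ℝ} (hτ : 0 < τ) :
    HasDerivAt (fun τ => heatKernel m p x τ z)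
      ((p - 1 / (2 * τ) + m * (z - x - m * τ) / (2 * τ) + (z - x - m * τ) ^ 2 / (4 * τ ^ 2))
        * heatKernel m p x τ z) τ := by
  have h0 : HasDerivAt (fun τ : ℝ => z - x - m * τ) (-m) τ := by
    simpa using ((hasDerivAt_id τ).const_mul m).const_sub (z - x)
  have h1 : HasDerivAt (fun τ : ℝ => 4 * Real.pi * τ) (4 * Real.pi) τ := by
    simpa using (hasDerivAt_id τ).const_mul (4 * Real.pi)
  have h2 : HasDerivAt (fun τ : ℝ => 4 * τ) 4 τ := by
    simpa using (hasDerivAt_id τ).const_mul 4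
  have h3 : HasDerivAt (fun τ : ℝ => p * τ) p τ := by
    simpa using (hasDerivAt_id τ).const_mul p
  have hne : 4 * Real.pi * τ ≠ 0 := by positivity
  have h4 := ((h3.sub ((h1.log hne).div_const 2)).sub
    ((h0.pow 2).div h2 (by positivity))).exp
  refine h4.congr_deriv ?_
  rw [mul_comm]
  have hpi := Real.pi_pos
  simp only [heatKernel]
  congr 1
  simp only [Pi.pow_apply, Nat.cast_ofNat]
  field_simp
  ring

theorem contDiffAt_heatKernel (m p x : ℝ) {τ z : ℝ} (hτ : 0 < τ) :
    ContDiffAt ℝ ∞ (fun y : ℝ × ℝ => heatKernel m p x y.1 y.2) (τ, z) := by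
  have hpi := Real.pi_pos
  unfold heatKernel
  refine ContDiffAt.exp (ContDiffAt.sub (ContDiffAt.sub (by fun_prop) ?_) ?_)
  · exact (ContDiffAt.log (by fun_prop) (by positivity)).div_const 2
  · exact ContDiffAt.div (by fun_prop) (by fun_prop) (by positivity)

theorem continuousOn_heatKernel (m p x : ℝ) :
    ContinuousOn (fun y : ℝ × ℝ => heatKernel m p x y.1 y.2) (Ioi 0 ×ˢ univ) := fun y hy =>
  (contDiffAt_heatKernel m p x (z := y.2) hy.1).continuousAt.continuousWithinAt

theorem continuousOn_heatKernelDeriv (m p x : ℝ) :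
    ContinuousOn (fun y : ℝ × ℝ => heatKernelDeriv m p x y.1 y.2) (Ioi 0 ×ˢ univ) := by
  unfold heatKernelDeriv
  refine ContinuousOn.mul ?_ (continuousOn_heatKernel m p x)
  refine ContinuousOn.div (by fun_prop) (by fun_prop) fun y hy => ?_
  have : 0 < y.1 := hy.1
  positivity

theorem continuousOn_backward_heatKernel {m p x S a b : ℝ} (hbS : b < S) :
    ContinuousOn (Function.uncurry fun t z => heatKernel m p x (S - t) z) (Icc a b ×ˢ univ) :=
  (continuousOn_heatKernel m p x).comp (f := fun y : ℝ × ℝ => (S - y.1, y.2)) (by fun_prop)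
    fun y hy => ⟨by simp only [mem_Ioi]; linarith [hy.1.2], mem_univ _⟩

/-- The factor of `w` in the error terms produced by a spatial cutoff. -/
theorem continuousOn_cutoff_terms {m p x S a b : ℝ} (hbS : b < S) {χ : ℝ → ℝ}
    (hχ : ContDiff ℝ ∞ χ) :
    ContinuousOn (Function.uncurry fun t z => deriv (deriv χ) z * heatKernel m p x (S - t) z
      + 2 * deriv χ z * heatKernelDeriv m p x (S - t) z
      - m * deriv χ z * heatKernel m p x (S - t) z) (Icc a b ×ˢ univ) := by
  have hχ1 : ContDiff ℝ ∞ (deriv χ) := (contDiff_infty_iff_deriv.1 hχ).2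
  have hχ2 : ContDiff ℝ ∞ (deriv (deriv χ)) := (contDiff_infty_iff_deriv.1 hχ1).2
  have hG := continuousOn_backward_heatKernel (m := m) (p := p) (x := x) (a := a) hbS
  have hG' : ContinuousOn (Function.uncurry fun t z => heatKernelDeriv m p x (S - t) z)
      (Icc a b ×ˢ univ) :=
    (continuousOn_heatKernelDeriv m p x).comp (f := fun y : ℝ × ℝ => (S - y.1, y.2))
      (by fun_prop) fun y hy => ⟨by simp only [mem_Ioi]; linarith [hy.1.2], mem_univ _⟩
  have hχ1s : ContinuousOn (fun y : ℝ × ℝ => deriv χ y.2) (Icc a b ×ˢ univ) :=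
    (hχ1.continuous.comp continuous_snd).continuousOn
  have hχ2s : ContinuousOn (fun y : ℝ × ℝ => deriv (deriv χ) y.2) (Icc a b ×ˢ univ) :=
    (hχ2.continuous.comp continuous_snd).continuousOn
  exact ((hχ2s.mul hG).add ((continuousOn_const.mul hχ1s).mul hG')).sub
    ((continuousOn_const.mul hχ1s).mul hG)

theorem deriv_eq_zero_of_notMem_tsupport {χ : ℝ → ℝ} {z : ℝ} (hz : z ∉ tsupport χ) :
    deriv χ z = 0 :=
  image_eq_zero_of_notMem_tsupport fun h => hz (tsupport_deriv_subset h)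

theorem deriv_deriv_eq_zero_of_notMem_tsupport {χ : ℝ → ℝ} {z : ℝ} (hz : z ∉ tsupport χ) :
    deriv (deriv χ) z = 0 :=
  deriv_eq_zero_of_notMem_tsupport fun h => hz (tsupport_deriv_subset h)

theorem integrable_slice_of_continuousOn {s K : Set ℝ} (hK : IsCompact K) {f : ℝ → ℝ → ℝ}
    (hf : ContinuousOn (Function.uncurry f) (s ×ˢ univ)) (hf0 : ∀ t, ∀ z ∉ K, f t z = 0)
    {t : ℝ} (ht : t ∈ s) : Integrable (f t) := by
  have hcont : Continuous (f t) := by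
    rw [← continuousOn_univ]
    exact hf.comp (f := fun z : ℝ => (t, z)) (by fun_prop) fun z _ => ⟨ht, mem_univ _⟩
  exact hcont.integrable_of_hasCompactSupport (HasCompactSupport.intro hK fun z hz => hf0 t z hz)

set_option maxHeartbeats 1000000 in
/-- Testing the equation with a time cutoff, a space cutoff `χ` and the backward heat kernel
with pole beyond the final time: the spatial pairing evolves by the source and by terms that
contain a derivative of `χ`. -/
theorem heatKernel_cutoff_identity {m p x S a b : ℝ} (ha : 0 ≤ a) (hab : a ≤ b) (hbS : b < S)
    {w F : ℝ → ℝ → ℝ} (hw : Continuous (Function.uncurry w))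
    (hF : Continuous (Function.uncurry F)) (hweak : IsWeakSolution m p w F)
    {χ : ℝ → ℝ} (hχ : ContDiff ℝ ∞ χ) (hχc : HasCompactSupport χ) :
    (∫ z, w b z * (χ z * heatKernel m p x (S - b) z))
      - (∫ z, w a z * (χ z * heatKernel m p x (S - a) z))
      = ∫ t in a..b, ((∫ z, F t z * (χ z * heatKernel m p x (S - t) z))
        + ∫ z, w t z * (deriv (deriv χ) z * heatKernel m p x (S - t) z
          + 2 * deriv χ z * heatKernelDeriv m p x (S - t) z
          - m * deriv χ z * heatKernel m p x (S - t) z)) := by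
  set G : ℝ → ℝ → ℝ := fun t z => heatKernel m p x (S - t) z with hG
  set G' : ℝ → ℝ → ℝ := fun t z => heatKernelDeriv m p x (S - t) z with hG'
  have hGc := continuousOn_backward_heatKernel (m := m) (p := p) (x := x) (a := a) hbS
  have hχ1 : ContDiff ℝ ∞ (deriv χ) := (contDiff_infty_iff_deriv.1 hχ).2
  have hz0 : ∀ z, z ∉ tsupport χ → χ z = 0 := fun z hz => image_eq_zero_of_notMem_tsupport hz
  -- the three integrands
  set f0 : ℝ → ℝ → ℝ := fun t z => w t z * (χ z * G t z) with hf0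
  set f1 : ℝ → ℝ → ℝ := fun t z => F t z * (χ z * G t z) with hf1
  set f2 : ℝ → ℝ → ℝ := fun t z => w t z * (deriv (deriv χ) z * G t z
    + 2 * deriv χ z * G' t z - m * deriv χ z * G t z) with hf2
  have hχs : ContinuousOn (fun y : ℝ × ℝ => χ y.2) (Icc a b ×ˢ univ) :=
    (hχ.continuous.comp continuous_snd).continuousOn
  have hc0 : ContinuousOn (Function.uncurry f0) (Icc a b ×ˢ univ) :=
    hw.continuousOn.mul (hχs.mul hGc)
  have hc1 : ContinuousOn (Function.uncurry f1) (Icc a b ×ˢ univ) :=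
    hF.continuousOn.mul (hχs.mul hGc)
  have hc2 : ContinuousOn (Function.uncurry f2) (Icc a b ×ˢ univ) :=
    hw.continuousOn.mul (continuousOn_cutoff_terms hbS hχ)
  have hcts : ∀ f : ℝ → ℝ → ℝ, ContinuousOn (Function.uncurry f) (Icc a b ×ˢ univ) →
      (∀ t z, z ∉ tsupport χ → f t z = 0) → ContinuousOn (fun t => ∫ z, f t z) (Icc a b) :=
    fun f hf hf0 => continuousOn_integral_of_compact_support hχc.isCompact hf
      fun t z _ hz => hf0 t z hz
  have hs0 : ∀ t z, z ∉ tsupport χ → f0 t z = 0 := fun t z hz => by simp [hf0, hz0 z hz]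
  have hs1 : ∀ t z, z ∉ tsupport χ → f1 t z = 0 := fun t z hz => by simp [hf1, hz0 z hz]
  have hs2 : ∀ t z, z ∉ tsupport χ → f2 t z = 0 := fun t z hz => by
    simp [hf2, deriv_eq_zero_of_notMem_tsupport hz, deriv_deriv_eq_zero_of_notMem_tsupport hz]
  have key := sub_eq_integral_of_weak_deriv hab (I := fun t => ∫ z, f0 t z)
    (A := fun t => -((∫ z, f1 t z) + ∫ z, f2 t z)) (hcts f0 hc0 hs0)
    ((hcts f1 hc1 hs1).add (hcts f2 hc2 hs2)).neg ?_
  · rw [intervalIntegral.integral_neg, neg_neg] at key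
    exact key
  intro θ hθ hθc hθs
  set φ : ℝ → ℝ → ℝ := fun t z => θ t * (χ z * G t z) with hφ
  have hθ0 : ∀ t, t ∉ Ioo a b → θ t = 0 := fun t ht =>
    image_eq_zero_of_notMem_tsupport fun h => ht (hθs h)
  have hθ1 : ∀ t, t ∉ Ioo a b → deriv θ t = 0 := fun t ht =>
    image_eq_zero_of_notMem_tsupport fun h => ht (hθs (tsupport_deriv_subset h))
  have hφK : ∀ y : ℝ × ℝ, y ∉ tsupport θ ×ˢ tsupport χ → Function.uncurry φ y = 0 := by
    rintro ⟨t, z⟩ hy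
    simp only [mem_prod, not_and_or] at hy
    rcases hy with hy | hy
    · simp [hφ, image_eq_zero_of_notMem_tsupport hy]
    · simp [hφ, hz0 z hy]
  have hφs : tsupport (Function.uncurry φ) ⊆ tsupport θ ×ˢ tsupport χ :=
    closure_minimal (fun y hy => by_contra fun h => hy (hφK y h))
      ((isClosed_tsupport _).prod (isClosed_tsupport _))
  have hφd : ContDiff ℝ ∞ (Function.uncurry φ) := by
    rw [contDiff_iff_contDiffAt]
    rintro ⟨t, z⟩
    by_cases ht : t < S
    · have h1 : ContDiffAt ℝ ∞ (fun y : ℝ × ℝ => G y.1 y.2) (t, z) :=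
        (contDiffAt_heatKernel m p x (z := z) (sub_pos.2 ht)).comp (t, z)
          (f := fun y : ℝ × ℝ => (S - y.1, y.2)) (by fun_prop)
      have h2 : ContDiffAt ℝ ∞ (fun y : ℝ × ℝ => θ y.1) (t, z) :=
        (hθ.comp contDiff_fst).contDiffAt
      have h3 : ContDiffAt ℝ ∞ (fun y : ℝ × ℝ => χ y.2) (t, z) :=
        (hχ.comp contDiff_snd).contDiffAt
      exact h2.mul (h3.mul h1)
    · refine (contDiffAt_const (c := (0 : ℝ))).congr_of_eventuallyEq ?_
      have hopen : IsOpen {y : ℝ × ℝ | b < y.1} := isOpen_lt continuous_const continuous_fst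
      filter_upwards [hopen.mem_nhds (show b < t by linarith [not_lt.1 ht])] with y hy
      have : θ y.1 = 0 := hθ0 _ fun h => absurd h.2 (not_lt.2 (le_of_lt hy))
      simp [Function.uncurry, hφ, this]
  have h0 := hweak φ hφd
    ((hθc.isCompact.prod hχc.isCompact).of_isClosed_subset (isClosed_tsupport _) hφs)
    (fun y hy => ⟨lt_of_le_of_lt ha (hθs (hφs hy).1).1, mem_univ _⟩)
  rw [← h0, ← setIntegral_eq_integral_of_forall_compl_eq_zero (s := Ioi (0 : ℝ))]
  swap
  · intro t ht
    have : t ∉ Ioo a b := fun h => ht (lt_of_le_of_lt ha h.1)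
    simp [hθ0 t this, hθ1 t this]
  refine integral_congr_ae (ae_of_all _ fun t => ?_)
  have hspace1 : ∀ z, HasDerivAt (φ t) (θ t * (deriv χ z * G t z + χ z * G' t z)) z := fun z =>
    ((((hχ.differentiable (by simp)) z).hasDerivAt.mul
      (hasDerivAt_heatKernel_space m p x (S - t) z))).const_mul (θ t)
  by_cases ht : t ∈ Ioo a b
  swap
  · have hφt : φ t = fun _ => 0 := by
      funext z; simp [hφ, hθ0 t ht]
    have hφd0 : ∀ z, deriv (fun τ => φ τ z) t = 0 := fun z => by
      have : t ∉ tsupport θ := fun h => ht (hθs h)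
      have hev : (fun τ => φ τ z) =ᶠ[𝓝 t] fun _ => 0 := by
        filter_upwards [notMem_tsupport_iff_eventuallyEq.1 this] with τ hτ
        simp [hφ, hτ]
      rw [hev.deriv_eq]
      simp
    simp only [hφd0, hφt, hθ0 t ht, hθ1 t ht]
    simp
  have htI : t ∈ Icc a b := Ioo_subset_Icc_self ht
  have hτ : 0 < S - t := by linarith [ht.2]
  have hspace2 : ∀ z, iteratedDeriv 2 (φ t) z = θ t * (deriv (deriv χ) z * G t z
      + 2 * deriv χ z * G' t z + χ z * (((z - x - m * (S - t)) ^ 2 / (4 * (S - t) ^ 2)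
        - 1 / (2 * (S - t))) * G t z)) := by
    intro z
    rw [iteratedDeriv_succ, iteratedDeriv_one, funext fun z => (hspace1 z).deriv]
    have h1 := (((hχ1.differentiable (by simp)) z).hasDerivAt.mul
      (hasDerivAt_heatKernel_space m p x (S - t) z)).add
      (((hχ.differentiable (by simp)) z).hasDerivAt.mul
      (hasDerivAt_heatKernelDeriv_space m p x z hτ))
    refine ((h1.const_mul (θ t)).congr_deriv ?_).deriv
    simp only [hG, hG']
    ring
  have htime : ∀ z, deriv (fun τ => φ τ z) t = deriv θ t * (χ z * G t z) - θ t * (χ z *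
      ((p - 1 / (2 * (S - t)) + m * (z - x - m * (S - t)) / (2 * (S - t))
        + (z - x - m * (S - t)) ^ 2 / (4 * (S - t) ^ 2)) * G t z)) := by
    intro z
    have h1 : HasDerivAt (fun t => G t z) _ t :=
      (hasDerivAt_heatKernel_time m p x z hτ).comp t ((hasDerivAt_id t).const_sub S)
    refine (((((hθ.differentiable (by simp)) t).hasDerivAt).mul
      (h1.const_mul (χ z))).congr_deriv ?_).deriv
    simp only [hG]
    ring
  have hI0 := integrable_slice_of_continuousOn hχc.isCompact hc0 hs0 htI
  have hI1 := integrable_slice_of_continuousOn hχc.isCompact hc1 hs1 htI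
  have hI2 := integrable_slice_of_continuousOn hχc.isCompact hc2 hs2 htI
  have hcomb : (-(deriv θ t) * (∫ z, f0 t z) + θ t * -((∫ z, f1 t z) + ∫ z, f2 t z))
      = ∫ z, (-(deriv θ t) * f0 t z + θ t * -(f1 t z + f2 t z)) := by
    rw [← integral_add hI1 hI2, ← integral_neg, ← integral_const_mul, ← integral_const_mul]
    exact (integral_add (hI0.const_mul _) ((hI1.add hI2).neg.const_mul _)).symm
  simp only []
  rw [hcomb]
  refine integral_congr_ae (ae_of_all _ fun z => ?_)
  simp only [htime z, hspace2 z, (hspace1 z).deriv]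
  simp only [hf0, hf1, hf2, hφ, hG', heatKernelDeriv]
  have hg : heatKernel m p x (S - t) z = G t z := rfl
  rw [hg]
  field_simp
  ring

/-! ### The heat semigroup on functions of Gaussian growth -/

/-- The law at time `τ ≥ 0` of a Brownian motion with variance `2 τ` and drift `m`, started
at `x`. -/
noncomputable def heatMeasure (m τ x : ℝ) : Measure ℝ :=
  ProbabilityTheory.gaussianReal (x + m * τ) (2 * τ).toNNReal

instance (m τ x : ℝ) : IsProbabilityMeasure (heatMeasure m τ x) := by
  unfold heatMeasure; infer_instance

/-- The semigroup generated by `∂_zz + m ∂_z + p`; it is the identity for `τ = 0`. -/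
noncomputable def heatOp (m p τ : ℝ) (f : ℝ → ℝ) (x : ℝ) : ℝ :=
  Real.exp (p * τ) * ∫ z, f z ∂heatMeasure m τ x

theorem heatMeasure_eq_map (m x : ℝ) {τ : ℝ} (hτ : 0 ≤ τ) :
    heatMeasure m τ x
      = (ProbabilityTheory.gaussianReal 0 2).map (fun y => x + m * τ + √τ * y) := by
  have h1 : (fun y : ℝ => x + m * τ + √τ * y) = (fun y => x + m * τ + y) ∘ (fun y => √τ * y) :=
    rfl
  rw [h1, ← Measure.map_map (by fun_prop) (by fun_prop),
    ProbabilityTheory.gaussianReal_map_const_mul, ProbabilityTheory.gaussianReal_map_const_add,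
    heatMeasure]
  congr 1
  · ring
  · ext
    push_cast
    rw [Real.coe_toNNReal _ (by positivity), Real.sq_sqrt hτ]
    ring

theorem integral_heatMeasure (m x : ℝ) {τ : ℝ} (hτ : 0 ≤ τ) (f : ℝ → ℝ)
    (hf : AEStronglyMeasurable f (heatMeasure m τ x)) :
    ∫ z, f z ∂heatMeasure m τ x
      = ∫ y, f (x + m * τ + √τ * y) ∂ProbabilityTheory.gaussianReal 0 2 := by
  rw [heatMeasure_eq_map m x hτ] at hf ⊢
  exact integral_map (by fun_prop) hf

theorem heatOp_zero (m p : ℝ) (f : ℝ → ℝ) (x : ℝ) : heatOp m p 0 f x = f x := by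
  simp [heatOp, heatMeasure]

theorem heatKernel_eq_gaussianPDFReal (m p x z : ℝ) {τ : ℝ} (hτ : 0 < τ) :
    heatKernel m p x τ z = Real.exp (p * τ)
      * ProbabilityTheory.gaussianPDFReal (x + m * τ) (2 * τ).toNNReal z := by
  have hpi := Real.pi_pos
  rw [heatKernel, ProbabilityTheory.gaussianPDFReal_def]
  simp only [Real.coe_toNNReal (2 * τ) (by positivity)]
  rw [show (2 * Real.pi * (2 * τ)) = 4 * Real.pi * τ by ring, ← Real.exp_log (x := (√_)⁻¹)
    (by positivity), ← Real.exp_add, ← Real.exp_add, Real.log_inv, Real.log_sqrt (by positivity)]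
  congr 1
  ring

theorem heatOp_eq_integral_heatKernel (m p x : ℝ) {τ : ℝ} (hτ : 0 < τ) (f : ℝ → ℝ) :
    heatOp m p τ f x = ∫ z, f z * heatKernel m p x τ z := by
  have hv : (2 * τ).toNNReal ≠ 0 := by simpa using hτ
  rw [heatOp, heatMeasure, ProbabilityTheory.integral_gaussianReal_eq_integral_smul hv,
    ← integral_const_mul]
  refine integral_congr_ae (ae_of_all _ fun z => ?_)
  simp only [heatKernel_eq_gaussianPDFReal m p x z hτ, smul_eq_mul]
  ring

theorem integrable_exp_sq_gaussianReal :
    Integrable (fun y : ℝ => Real.exp (y ^ 2 / 8)) (ProbabilityTheory.gaussianReal 0 2) := by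
  rw [ProbabilityTheory.gaussianReal_of_var_ne_zero _ two_ne_zero,
    integrable_withDensity_iff (by fun_prop) (ae_of_all _ fun _ =>
      ProbabilityTheory.gaussianPDF_lt_top)]
  simp only [ProbabilityTheory.toReal_gaussianPDF]
  have h := (integrable_exp_neg_mul_sq (b := 1 / 8) (by norm_num)).const_mul
    (√(2 * Real.pi * 2))⁻¹
  refine h.congr (ae_of_all _ fun y => ?_)
  simp only [ProbabilityTheory.gaussianPDFReal_def, NNReal.coe_ofNat]
  rw [mul_left_comm, ← Real.exp_add]
  congr 2
  ring

/-- Along the heat flow for times at most `ε`, with `16 a ε ≤ 1`, Gaussian growth of rate `a` is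
dominated by one integrable function of the normalised variable. -/
theorem exp_sq_le_of_le {m x a ε τ : ℝ} (ha : 0 ≤ a) (hε : 16 * a * ε ≤ 1)
    (hτ : τ ∈ Icc 0 ε) (y : ℝ) :
    Real.exp (a * (x + m * τ + √τ * y) ^ 2)
      ≤ Real.exp (2 * a * (|x| + |m| * ε) ^ 2) * Real.exp (y ^ 2 / 8) := by
  rw [← Real.exp_add]
  apply Real.exp_le_exp.2
  have h1 : |x + m * τ| ≤ |x| + |m| * ε := by
    refine (abs_add_le _ _).trans ?_
    rw [abs_mul, abs_of_nonneg hτ.1]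
    gcongr
    exact hτ.2
  have h2 : (x + m * τ) ^ 2 ≤ (|x| + |m| * ε) ^ 2 := sq_le_sq' (by
    linarith [neg_abs_le (x + m * τ)]) ((le_abs_self _).trans h1)
  have h3 : (x + m * τ + √τ * y) ^ 2 ≤ 2 * (x + m * τ) ^ 2 + 2 * (τ * y ^ 2) := by
    have : (√τ * y) ^ 2 = τ * y ^ 2 := by rw [mul_pow, Real.sq_sqrt hτ.1]
    nlinarith [sq_nonneg (x + m * τ - √τ * y)]
  have h4 : a * τ ≤ 1 / 16 := by nlinarith [mul_le_mul_of_nonneg_left hτ.2 ha]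
  nlinarith [mul_le_mul_of_nonneg_left h3 ha, mul_le_mul_of_nonneg_left h2 ha,
    mul_le_mul_of_nonneg_right h4 (sq_nonneg y)]

theorem growth_comp_le {m x a ε τ C : ℝ} (ha : 0 ≤ a) (hε : 16 * a * ε ≤ 1)
    (hτ : τ ∈ Icc 0 ε) {f : ℝ → ℝ} (hf : ∀ z, |f z| ≤ C * Real.exp (a * z ^ 2)) (y : ℝ) :
    |f (x + m * τ + √τ * y)|
      ≤ C * Real.exp (2 * a * (|x| + |m| * ε) ^ 2) * Real.exp (y ^ 2 / 8) := by
  have hC : 0 ≤ C := by simpa using (abs_nonneg _).trans (hf 0)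
  refine (hf _).trans ?_
  rw [mul_assoc]
  exact mul_le_mul_of_nonneg_left (exp_sq_le_of_le ha hε hτ y) hC

theorem integrable_heatMeasure {m x a ε τ C : ℝ} (ha : 0 ≤ a) (hε : 16 * a * ε ≤ 1)
    (hτ : τ ∈ Icc 0 ε) {f : ℝ → ℝ} (hfc : Continuous f)
    (hf : ∀ z, |f z| ≤ C * Real.exp (a * z ^ 2)) : Integrable f (heatMeasure m τ x) := by
  rw [heatMeasure_eq_map m x hτ.1, integrable_map_measure (by fun_prop) (by fun_prop)]
  exact Integrable.mono' (integrable_exp_sq_gaussianReal.const_mul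
    (C * Real.exp (2 * a * (|x| + |m| * ε) ^ 2)))
    (hfc.comp (by fun_prop)).aestronglyMeasurable
    (ae_of_all _ fun y => growth_comp_le ha hε hτ hf y)

theorem exists_heatOp_bound (m p x : ℝ) {a ε : ℝ} (ha : 0 ≤ a) (hε : 16 * a * ε ≤ 1) :
    ∃ B, ∀ τ ∈ Icc 0 ε, ∀ (f : ℝ → ℝ) (C : ℝ), Continuous f →
      (∀ z, |f z| ≤ C * Real.exp (a * z ^ 2)) → |heatOp m p τ f x| ≤ B * C := by
  refine ⟨Real.exp (|p| * ε) * (Real.exp (2 * a * (|x| + |m| * ε) ^ 2)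
    * ∫ y, Real.exp (y ^ 2 / 8) ∂ProbabilityTheory.gaussianReal 0 2), fun τ hτ f C hfc hf => ?_⟩
  rw [heatOp, integral_heatMeasure m x hτ.1 f hfc.aestronglyMeasurable, abs_mul, Real.abs_exp,
    mul_assoc]
  have h1 : Real.exp (p * τ) ≤ Real.exp (|p| * ε) := by
    apply Real.exp_le_exp.2
    exact mul_le_mul (le_abs_self p) hτ.2 hτ.1 (abs_nonneg p)
  refine mul_le_mul h1 ?_ (abs_nonneg _) (Real.exp_pos _).le
  refine (norm_integral_le_of_norm_le (f := fun y => f (x + m * τ + √τ * y))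
    (integrable_exp_sq_gaussianReal.const_mul (C * Real.exp (2 * a * (|x| + |m| * ε) ^ 2)))
    (ae_of_all _ fun y => growth_comp_le ha hε hτ hf y)).trans_eq ?_
  rw [integral_const_mul]
  ring

theorem continuousOn_heatOp (m p x : ℝ) {a ε C : ℝ} (ha : 0 ≤ a) (hε : 16 * a * ε ≤ 1)
    {s : Set ℝ} {f : ℝ → ℝ → ℝ} (hfc : ContinuousOn (Function.uncurry f) (s ×ˢ univ))
    (hf : ∀ t ∈ s, ∀ z, |f t z| ≤ C * Real.exp (a * z ^ 2)) :
    ContinuousOn (fun y : ℝ × ℝ => heatOp m p y.1 (f y.2) x) (Icc 0 ε ×ˢ s) := by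
  have hft : ∀ t ∈ s, Continuous (f t) := fun t ht => by
    rw [← continuousOn_univ]
    exact hfc.comp (f := fun z : ℝ => (t, z)) (by fun_prop) fun z _ => ⟨ht, mem_univ _⟩
  have h1 : ContinuousOn (fun y : ℝ × ℝ => Real.exp (p * y.1)
      * ∫ u, f y.2 (x + m * y.1 + √y.1 * u) ∂ProbabilityTheory.gaussianReal 0 2)
      (Icc 0 ε ×ˢ s) := by
    refine ContinuousOn.mul (by fun_prop) ?_
    refine continuousOn_of_dominated (bound := fun u => C * Real.exp (2 * a * (|x| + |m| * ε) ^ 2)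
      * Real.exp (u ^ 2 / 8)) ?_ ?_ (integrable_exp_sq_gaussianReal.const_mul _) ?_
    · intro y hy
      exact ((hft y.2 hy.2).comp (by fun_prop)).aestronglyMeasurable
    · exact fun y hy => ae_of_all _ fun u => growth_comp_le ha hε hy.1 (hf y.2 hy.2) u
    · refine ae_of_all _ fun u => ?_
      exact hfc.comp (f := fun y : ℝ × ℝ => (y.2, x + m * y.1 + √y.1 * u)) (by fun_prop)
        fun y hy => ⟨hy.2, mem_univ _⟩
  refine h1.congr fun y hy => ?_
  simp only [heatOp, integral_heatMeasure m x hy.1.1 _ (hft y.2 hy.2).aestronglyMeasurable]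

/-! ### Duhamel's formula -/

/-- Smooth compactly supported cutoffs of the line, equal to `1` on larger and larger intervals,
whose first and second derivatives tend to zero uniformly. -/
theorem exists_smooth_cutoff : ∃ (χ : ℕ → ℝ → ℝ) (K : ℝ), 0 ≤ K ∧
    ∀ n, ContDiff ℝ ∞ (χ n) ∧ HasCompactSupport (χ n) ∧ (∀ z, |χ n z| ≤ 1) ∧
      (∀ z : ℝ, |z| ≤ n + 1 → χ n z = 1) ∧
      (∀ z, |deriv (χ n) z| ≤ K / (n + 1)) ∧ ∀ z, |deriv (deriv (χ n)) z| ≤ K / (n + 1) := by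
  let β : ContDiffBump (0 : ℝ) := ⟨1, 2, one_pos, one_lt_two⟩
  have hβ : ContDiff ℝ ∞ (β : ℝ → ℝ) := β.contDiff
  have hβ1 : ContDiff ℝ ∞ (deriv (β : ℝ → ℝ)) := (contDiff_infty_iff_deriv.1 hβ).2
  have hβ2 : ContDiff ℝ ∞ (deriv (deriv (β : ℝ → ℝ))) := (contDiff_infty_iff_deriv.1 hβ1).2
  obtain ⟨K1, hK1⟩ := hβ1.continuous.bounded_above_of_compact_support
    β.hasCompactSupport.deriv
  obtain ⟨K2, hK2⟩ := hβ2.continuous.bounded_above_of_compact_support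
    β.hasCompactSupport.deriv.deriv
  have hK10 : 0 ≤ K1 := (norm_nonneg _).trans (hK1 0)
  have hK20 : 0 ≤ K2 := (norm_nonneg _).trans (hK2 0)
  refine ⟨fun n z => β (((n : ℝ) + 1)⁻¹ * z), K1 + K2, by positivity, fun n => ?_⟩
  have hn : (0 : ℝ) < (n : ℝ) + 1 := by positivity
  have hn1 : ((n : ℝ) + 1)⁻¹ ≤ 1 := inv_le_one_of_one_le₀ (by linarith [n.cast_nonneg (α := ℝ)])
  have hd1 : deriv (fun z => β (((n : ℝ) + 1)⁻¹ * z))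
      = fun z => ((n : ℝ) + 1)⁻¹ * deriv β (((n : ℝ) + 1)⁻¹ * z) := by
    funext z
    exact deriv_comp_mul_left _ (β : ℝ → ℝ) z
  have hd2 : deriv (deriv fun z => β (((n : ℝ) + 1)⁻¹ * z))
      = fun z => ((n : ℝ) + 1)⁻¹ * (((n : ℝ) + 1)⁻¹ * deriv (deriv β) (((n : ℝ) + 1)⁻¹ * z)) := by
    rw [hd1]
    funext z
    rw [deriv_const_mul_field]
    congr 1
    exact deriv_comp_mul_left _ (deriv (β : ℝ → ℝ)) z
  refine ⟨hβ.comp (by fun_prop), ?_, ?_, ?_, ?_, ?_⟩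
  · exact β.hasCompactSupport.comp_homeomorph (Homeomorph.mulLeft₀ _ (inv_ne_zero hn.ne'))
  · intro z
    rw [abs_of_nonneg β.nonneg]
    exact β.le_one
  · intro z hz
    apply β.one_of_mem_closedBall
    rw [mem_closedBall_zero_iff, Real.norm_eq_abs, abs_mul, abs_of_pos (inv_pos.2 hn)]
    rw [inv_mul_le_iff₀ hn]
    simpa [β] using hz
  · intro z
    rw [hd1, abs_mul, abs_of_pos (inv_pos.2 hn), div_eq_inv_mul]
    have := hK1 (((n : ℝ) + 1)⁻¹ * z)
    rw [Real.norm_eq_abs] at this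
    gcongr
    linarith
  · intro z
    rw [hd2, abs_mul, abs_mul, abs_of_pos (inv_pos.2 hn), div_eq_inv_mul]
    have := hK2 (((n : ℝ) + 1)⁻¹ * z)
    rw [Real.norm_eq_abs] at this
    refine mul_le_mul_of_nonneg_left ?_ (inv_pos.2 hn).le
    calc _ ≤ 1 * K2 := mul_le_mul hn1 this (abs_nonneg _) zero_le_one
      _ ≤ _ := by linarith

/-- The cutoff identity of `heatKernel_cutoff_identity` for a function `w` that need not be a
weak solution itself (a difference of solutions, say), as a property of the pair `(w, F)`. -/
def HasCutoffIdentity (m p : ℝ) (w F : ℝ → ℝ → ℝ) : Prop :=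
  ∀ x S a b : ℝ, 0 ≤ a → a ≤ b → b < S → ∀ χ : ℝ → ℝ, ContDiff ℝ ∞ χ → HasCompactSupport χ →
    (∫ z, w b z * (χ z * heatKernel m p x (S - b) z))
      - (∫ z, w a z * (χ z * heatKernel m p x (S - a) z))
      = ∫ t in a..b, ((∫ z, F t z * (χ z * heatKernel m p x (S - t) z))
        + ∫ z, w t z * (deriv (deriv χ) z * heatKernel m p x (S - t) z
          + 2 * deriv χ z * heatKernelDeriv m p x (S - t) z
          - m * deriv χ z * heatKernel m p x (S - t) z))

/-- The coefficient of the heat kernel in the error terms produced by the cutoff `χ`. -/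
noncomputable def cutoffError (m x S : ℝ) (χ : ℝ → ℝ) (t z : ℝ) : ℝ :=
  deriv (deriv χ) z - deriv χ z * (z - x - m * (S - t)) / (S - t) - m * deriv χ z

/-- The cutoff identity, with all pairings written through the heat semigroup. -/
theorem HasCutoffIdentity.heatOp_eq {m p : ℝ} {w F : ℝ → ℝ → ℝ} (h : HasCutoffIdentity m p w F)
    {x S a b : ℝ} (ha : 0 ≤ a) (hab : a ≤ b) (hbS : b < S) {χ : ℝ → ℝ} (hχ : ContDiff ℝ ∞ χ)
    (hχc : HasCompactSupport χ) :
    heatOp m p (S - b) (fun z => w b z * χ z) x - heatOp m p (S - a) (fun z => w a z * χ z) x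
      = ∫ t in a..b, (heatOp m p (S - t) (fun z => F t z * χ z) x
        + heatOp m p (S - t) (fun z => w t z * cutoffError m x S χ t z) x) := by
  rw [heatOp_eq_integral_heatKernel _ _ _ (by linarith), heatOp_eq_integral_heatKernel _ _ _
    (by linarith)]
  simp only [mul_assoc]
  rw [h x S a b ha hab hbS χ hχ hχc]
  refine intervalIntegral.integral_congr fun t ht => ?_
  rw [uIcc_of_le hab] at ht
  have hτ : 0 < S - t := by linarith [ht.2]
  simp only [heatOp_eq_integral_heatKernel _ _ _ hτ, mul_assoc]
  congr 1
  refine integral_congr_ae (ae_of_all _ fun z => ?_)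
  simp only [heatKernelDeriv, cutoffError]
  field_simp
  ring

theorem abs_cutoffError_le {m x S a b t K' : ℝ} (hS : b < S) (ht : t ∈ Icc a b) {χ : ℝ → ℝ}
    (h1 : ∀ z, |deriv χ z| ≤ K') (h2 : ∀ z, |deriv (deriv χ) z| ≤ K') (z : ℝ) :
    |cutoffError m x S χ t z|
      ≤ K' * (1 + (1 + |x| + |m| * (S - a)) / (S - b) + |m|) * Real.exp (1 * z ^ 2) := by
  have hK' : 0 ≤ K' := (abs_nonneg _).trans (h1 0)
  have hδ : 0 < S - b := sub_pos.2 hS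
  have hτ : 0 < S - t := by linarith [ht.2]
  have hz : |z| ≤ Real.exp (1 * z ^ 2) := by
    have := Real.add_one_le_exp (1 * z ^ 2)
    nlinarith [sq_nonneg (|z| - 1), sq_abs z]
  have hz1 : 1 ≤ Real.exp (1 * z ^ 2) := Real.one_le_exp (by positivity)
  have hnum : |z - x - m * (S - t)| ≤ (1 + |x| + |m| * (S - a)) * Real.exp (1 * z ^ 2) := by
    have e1 : |z - x - m * (S - t)| ≤ |z| + |x| + |m| * (S - a) := by
      refine (abs_sub _ _).trans (add_le_add (abs_sub _ _) ?_)
      rw [abs_mul, abs_of_pos hτ]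
      exact mul_le_mul_of_nonneg_left (by linarith [ht.1]) (abs_nonneg m)
    have e2 : 0 ≤ |x| + |m| * (S - a) := by
      have : 0 ≤ S - a := by linarith [ht.1, ht.2]
      positivity
    nlinarith [mul_le_mul_of_nonneg_left hz1 e2]
  have hquot : |(z - x - m * (S - t)) / (S - t)|
      ≤ (1 + |x| + |m| * (S - a)) / (S - b) * Real.exp (1 * z ^ 2) := by
    rw [abs_div, abs_of_pos hτ, div_mul_eq_mul_div]
    exact div_le_div₀ ((abs_nonneg _).trans hnum) hnum hδ (by linarith [ht.2])
  rw [cutoffError]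
  calc |deriv (deriv χ) z - deriv χ z * (z - x - m * (S - t)) / (S - t) - m * deriv χ z|
      ≤ |deriv (deriv χ) z| + |deriv χ z| * |(z - x - m * (S - t)) / (S - t)|
        + |m| * |deriv χ z| := by
        refine (abs_sub _ _).trans (add_le_add ((abs_sub _ _).trans (add_le_add le_rfl ?_)) ?_)
        · rw [mul_div_assoc, abs_mul]
        · rw [abs_mul]
    _ ≤ K' * Real.exp (1 * z ^ 2) + K' * ((1 + |x| + |m| * (S - a)) / (S - b)
        * Real.exp (1 * z ^ 2)) + |m| * (K' * Real.exp (1 * z ^ 2)) := by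
        refine add_le_add (add_le_add ?_ ?_) ?_
        · exact (h2 z).trans (le_mul_of_one_le_right hK' hz1)
        · exact mul_le_mul (h1 z) hquot (abs_nonneg _) hK'
        · exact mul_le_mul_of_nonneg_left ((h1 z).trans (le_mul_of_one_le_right hK' hz1))
            (abs_nonneg m)
    _ = _ := by ring

/-- Duhamel's formula against the heat kernel with its pole at a time `S` beyond `b`: the spatial
cutoff is removed, which Gaussian growth allows for short times. -/
theorem HasCutoffIdentity.heatOp_sub_eq {m p : ℝ} {w F : ℝ → ℝ → ℝ}
    (h : HasCutoffIdentity m p w F) (hw : Continuous (Function.uncurry w))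
    (hF : Continuous (Function.uncurry F)) {x S a b r C : ℝ} (ha : 0 ≤ a) (hab : a ≤ b)
    (hbS : b < S) (hr : 0 ≤ r) (hS : 16 * (r + 1) * (S - a) ≤ 1)
    (hwg : ∀ t ∈ Icc a b, ∀ z, |w t z| ≤ C * Real.exp (r * z ^ 2))
    (hFg : ∀ t ∈ Icc a b, ∀ z, |F t z| ≤ C * Real.exp (r * z ^ 2)) :
    heatOp m p (S - b) (w b) x - heatOp m p (S - a) (w a) x
      = ∫ t in a..b, heatOp m p (S - t) (F t) x := by
  obtain ⟨χ, K, hK, hχ⟩ := exists_smooth_cutoff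
  have hC : 0 ≤ C := by
    simpa using (abs_nonneg _).trans (hwg a (left_mem_Icc.2 hab) 0)
  have hSa : 0 < S - a := by linarith
  have hS' : 16 * r * (S - a) ≤ 1 := by nlinarith
  have hmem : ∀ t ∈ Icc a b, S - t ∈ Icc 0 (S - a) := fun t ht =>
    ⟨by linarith [ht.2], by linarith [ht.1]⟩
  have hslice : ∀ f : ℝ → ℝ → ℝ, Continuous (Function.uncurry f) → ∀ t, Continuous (f t) :=
    fun f hf t => hf.comp (by fun_prop : Continuous fun z : ℝ => (t, z))
  have hχle : ∀ f : ℝ → ℝ → ℝ, (∀ t ∈ Icc a b, ∀ z, |f t z| ≤ C * Real.exp (r * z ^ 2)) →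
      ∀ n, ∀ t ∈ Icc a b, ∀ z, |f t z * χ n z| ≤ C * Real.exp (r * z ^ 2) := by
    intro f hf n t ht z
    rw [abs_mul]
    exact (mul_le_of_le_one_right (abs_nonneg _) ((hχ n).2.2.1 z)).trans (hf t ht z)
  -- removing the cutoff at a fixed time
  have hlim : ∀ f : ℝ → ℝ → ℝ, Continuous (Function.uncurry f) →
      (∀ t ∈ Icc a b, ∀ z, |f t z| ≤ C * Real.exp (r * z ^ 2)) → ∀ t ∈ Icc a b,
      Tendsto (fun n => heatOp m p (S - t) (fun z => f t z * χ n z) x) atTop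
        (𝓝 (heatOp m p (S - t) (f t) x)) := by
    intro f hfc hf t ht
    refine Tendsto.const_mul _ (tendsto_integral_of_dominated_convergence (fun z => |f t z|)
      (fun n => ((hslice f hfc t).mul (hχ n).1.continuous).aestronglyMeasurable)
      (integrable_heatMeasure hr hS' (hmem t ht) (hslice f hfc t) (hf t ht)).abs
      (fun n => ae_of_all _ fun z => ?_) (ae_of_all _ fun z => ?_))
    · rw [Real.norm_eq_abs, abs_mul]
      exact mul_le_of_le_one_right (abs_nonneg _) ((hχ n).2.2.1 z)
    · refine tendsto_const_nhds.congr' ?_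
      filter_upwards [eventually_ge_atTop ⌈|z|⌉₊] with n hn
      rw [(hχ n).2.2.2.1 z, mul_one]
      have : |z| ≤ n := (Nat.le_ceil _).trans (by exact_mod_cast hn)
      linarith
  have hcts : ∀ (f : ℝ → ℝ → ℝ) (C' r' : ℝ), 0 ≤ r' → 16 * r' * (S - a) ≤ 1 →
      ContinuousOn (Function.uncurry f) (Icc a b ×ˢ univ) →
      (∀ t ∈ Icc a b, ∀ z, |f t z| ≤ C' * Real.exp (r' * z ^ 2)) →
      ContinuousOn (fun t => heatOp m p (S - t) (f t) x) (Icc a b) := by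
    intro f C' r' hr' hSr hfc hf
    exact (continuousOn_heatOp m p x hr' hSr hfc hf).comp (f := fun t : ℝ => (S - t, t))
      (by fun_prop) fun t ht => ⟨hmem t ht, ht⟩
  obtain ⟨B, hB⟩ := exists_heatOp_bound m p x hr hS'
  obtain ⟨B', hB'⟩ := exists_heatOp_bound m p x (by linarith : 0 ≤ r + 1) hS
  set D : ℝ := 1 + (1 + |x| + |m| * (S - a)) / (S - b) + |m| with hD
  have herr : ∀ n, ∀ t ∈ Icc a b, ∀ z, |w t z * cutoffError m x S (χ n) t z|
      ≤ (C * (K / (n + 1) * D)) * Real.exp ((r + 1) * z ^ 2) := by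
    intro n t ht z
    rw [abs_mul, add_mul, Real.exp_add]
    calc _ ≤ (C * Real.exp (r * z ^ 2)) * (K / (n + 1) * D * Real.exp (1 * z ^ 2)) :=
          mul_le_mul (hwg t ht z) (abs_cutoffError_le hbS ht (hχ n).2.2.2.2.1 (hχ n).2.2.2.2.2 z)
            (abs_nonneg _) (by positivity)
      _ = _ := by ring
  have hErrC : ∀ n, ContinuousOn
      (Function.uncurry fun t z => w t z * cutoffError m x S (χ n) t z) (Icc a b ×ˢ univ) := by
    intro n
    have hd1 : ContDiff ℝ ∞ (deriv (χ n)) := (contDiff_infty_iff_deriv.1 (hχ n).1).2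
    have hd2 : ContDiff ℝ ∞ (deriv (deriv (χ n))) := (contDiff_infty_iff_deriv.1 hd1).2
    have c1 : Continuous fun y : ℝ × ℝ => deriv (χ n) y.2 := hd1.continuous.comp continuous_snd
    have c2 : Continuous fun y : ℝ × ℝ => deriv (deriv (χ n)) y.2 :=
      hd2.continuous.comp continuous_snd
    refine hw.continuousOn.mul ((c2.continuousOn.sub (ContinuousOn.div ?_ (by fun_prop) ?_)).sub
      (continuousOn_const.mul c1.continuousOn))
    · exact c1.continuousOn.mul (by fun_prop)
    · intro y hy
      have : 0 < S - y.1 := by linarith [hy.1.2]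
      exact this.ne'
  have hErrT : ∀ n, ∀ t ∈ Icc a b,
      |heatOp m p (S - t) (fun z => w t z * cutoffError m x S (χ n) t z) x|
        ≤ B' * (C * (K / (n + 1) * D)) := by
    intro n t ht
    refine hB' (S - t) (hmem t ht) _ _ ?_ (herr n t ht)
    rw [← continuousOn_univ]
    exact (hErrC n).comp (f := fun z : ℝ => (t, z)) (by fun_prop) fun z _ => ⟨ht, mem_univ _⟩
  have h0 : Tendsto (fun n : ℕ => B' * (C * (K / (n + 1) * D))) atTop (𝓝 0) := by
    have : Tendsto (fun n : ℕ => K / ((n : ℝ) + 1)) atTop (𝓝 0) :=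
      tendsto_const_nhds.div_atTop
        (tendsto_atTop_add_const_right _ _ tendsto_natCast_atTop_atTop)
    simpa using ((this.mul_const D).const_mul C).const_mul B'
  have hleft := (hlim w hw hwg b (right_mem_Icc.2 hab)).sub
    (hlim w hw hwg a (left_mem_Icc.2 hab))
  refine tendsto_nhds_unique hleft ?_
  have hB'0 : 0 ≤ B' * (C * (K * D)) := by
    simpa using (abs_nonneg _).trans (hErrT 0 a (left_mem_Icc.2 hab))
  have hright : Tendsto (fun n => ∫ t in a..b, (heatOp m p (S - t) (fun z => F t z * χ n z) x
        + heatOp m p (S - t) (fun z => w t z * cutoffError m x S (χ n) t z) x)) atTop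
      (𝓝 (∫ t in a..b, heatOp m p (S - t) (F t) x)) := by
    refine intervalIntegral.tendsto_integral_filter_of_dominated_convergence
      (fun _ => B * C + B' * (C * (K * D))) ?_ ?_ intervalIntegrable_const ?_
    · refine Eventually.of_forall fun n => ContinuousOn.aestronglyMeasurable ?_
        measurableSet_uIoc
      rw [uIoc_of_le hab]
      refine ContinuousOn.mono ?_ Ioc_subset_Icc_self
      refine ContinuousOn.add ?_ ?_
      · refine hcts (fun t z => F t z * χ n z) C r hr hS' ?_ (hχle F hFg n)
        exact (hF.mul ((hχ n).1.continuous.comp continuous_snd)).continuousOn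
      · exact hcts (fun t z => w t z * cutoffError m x S (χ n) t z) _ (r + 1) (by linarith) hS
          (hErrC n) (herr n)
    · refine Eventually.of_forall fun n => ae_of_all _ fun t ht => ?_
      rw [uIoc_of_le hab] at ht
      have ht' := Ioc_subset_Icc_self ht
      refine (norm_add_le _ _).trans (add_le_add ?_ ?_)
      · exact hB (S - t) (hmem t ht') _ _
          ((hslice F hF t).mul (hχ n).1.continuous) (hχle F hFg n t ht')
      · refine (hErrT n t ht').trans ?_
        have hn : (1 : ℝ) ≤ (n : ℝ) + 1 := by linarith [n.cast_nonneg (α := ℝ)]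
        have : B' * (C * (K / (n + 1) * D)) = B' * (C * (K * D)) / (n + 1) := by ring
        rw [this]
        exact div_le_self hB'0 hn
    · refine ae_of_all _ fun t ht => ?_
      rw [uIoc_of_le hab] at ht
      have ht' := Ioc_subset_Icc_self ht
      have := (hlim F hF hFg t ht').add (squeeze_zero_norm (fun n => hErrT n t ht') h0)
      rwa [add_zero] at this
  refine hright.congr fun n => ?_
  exact (h.heatOp_eq ha hab hbS (hχ n).1 (hχ n).2.1).symm

/-- Duhamel's formula on short time intervals for continuous weak solutions of Gaussian growth. -/
theorem HasCutoffIdentity.duhamel {m p : ℝ} {w F : ℝ → ℝ → ℝ}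
    (h : HasCutoffIdentity m p w F) (hw : Continuous (Function.uncurry w))
    (hF : Continuous (Function.uncurry F)) {a b r C : ℝ} (ha : 0 ≤ a) (hab : a ≤ b)
    (hr : 0 ≤ r) (hS : 16 * (r + 1) * (b - a) < 1)
    (hwg : ∀ t ∈ Icc a b, ∀ z, |w t z| ≤ C * Real.exp (r * z ^ 2))
    (hFg : ∀ t ∈ Icc a b, ∀ z, |F t z| ≤ C * Real.exp (r * z ^ 2)) (x : ℝ) :
    IntervalIntegrable (fun t => heatOp m p (b - t) (F t) x) volume a b ∧
    w b x = heatOp m p (b - a) (w a) x + ∫ t in a..b, heatOp m p (b - t) (F t) x := by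
  -- `ε` exceeds `b - a`, so that the pole of the kernel may be placed after `b`
  set ε : ℝ := 1 / (16 * (r + 1)) with hε
  have hr1 : 0 < 16 * (r + 1) := by linarith
  have hε1 : 16 * (r + 1) * ε = 1 := by rw [hε]; field_simp
  have hbε : b - a < ε := by
    rw [hε, lt_div_iff₀ hr1]; linarith
  have hε0 : 0 < ε := by positivity
  have hε' : 16 * r * ε ≤ 1 := by nlinarith
  have hcw := continuousOn_heatOp m p x hr hε' (s := Icc a b) hw.continuousOn hwg
  have hcF := continuousOn_heatOp m p x hr hε' (s := Icc a b) hF.continuousOn hFg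
  have hslice : ∀ t, Continuous (F t) :=
    fun t => hF.comp (by fun_prop : Continuous fun z : ℝ => (t, z))
  obtain ⟨B, hB⟩ := exists_heatOp_bound m p x hr hε'
  have hev : ∀ᶠ δ in 𝓝[>] (0 : ℝ), δ ∈ Ioo 0 (ε - (b - a)) :=
    Ioo_mem_nhdsGT (by linarith)
  have hev' : ∀ᶠ δ in 𝓝[>] (0 : ℝ), ∀ t ∈ Icc a b, b + δ - t ∈ Icc 0 ε := by
    filter_upwards [hev] with δ hδ t ht
    exact ⟨by linarith [ht.2, hδ.1], by linarith [ht.1, hδ.2]⟩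
  have hmem : ∀ t ∈ Icc a b, b - t ∈ Icc 0 ε := fun t ht =>
    ⟨by linarith [ht.2], by linarith [ht.1]⟩
  have hlim : ∀ f : ℝ → ℝ → ℝ, ContinuousOn (fun y : ℝ × ℝ => heatOp m p y.1 (f y.2) x)
      (Icc 0 ε ×ˢ Icc a b) → ∀ t ∈ Icc a b,
      Tendsto (fun δ => heatOp m p (b + δ - t) (f t) x) (𝓝[>] 0)
        (𝓝 (heatOp m p (b - t) (f t) x)) := by
    intro f hf t ht
    have h1 := hf (b - t, t) ⟨hmem t ht, ht⟩
    refine Tendsto.comp (f := fun δ : ℝ => (b + δ - t, t)) h1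
      (tendsto_nhdsWithin_iff.2 ⟨?_, ?_⟩)
    · have : Continuous fun δ : ℝ => (b + δ - t, t) := by fun_prop
      have h2 := this.tendsto 0
      simp only [add_zero] at h2
      exact h2.mono_left nhdsWithin_le_nhds
    · filter_upwards [hev'] with δ hδ
      exact ⟨hδ t ht, ht⟩
  have hint : ContinuousOn (fun t => heatOp m p (b - t) (F t) x) (Icc a b) :=
    hcF.comp (f := fun t : ℝ => (b - t, t)) (by fun_prop) fun t ht => ⟨hmem t ht, ht⟩
  refine ⟨ContinuousOn.intervalIntegrable (by rwa [uIcc_of_le hab]), ?_⟩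
  have hL := (hlim w hcw b (right_mem_Icc.2 hab)).sub (hlim w hcw a (left_mem_Icc.2 hab))
  have hR : Tendsto (fun δ => ∫ t in a..b, heatOp m p (b + δ - t) (F t) x) (𝓝[>] 0)
      (𝓝 (∫ t in a..b, heatOp m p (b - t) (F t) x)) := by
    refine intervalIntegral.tendsto_integral_filter_of_dominated_convergence
      (fun _ => B * C) ?_ ?_ intervalIntegrable_const ?_
    · filter_upwards [hev'] with δ hδ
      refine ContinuousOn.aestronglyMeasurable ?_ measurableSet_uIoc
      rw [uIoc_of_le hab]
      refine ContinuousOn.mono ?_ Ioc_subset_Icc_self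
      exact hcF.comp (f := fun t : ℝ => (b + δ - t, t)) (by fun_prop) fun t ht => ⟨hδ t ht, ht⟩
    · filter_upwards [hev'] with δ hδ
      refine ae_of_all _ fun t ht => ?_
      rw [uIoc_of_le hab] at ht
      have ht' := Ioc_subset_Icc_self ht
      exact hB _ (hδ t ht') _ _ (hslice t) (hFg t ht')
    · refine ae_of_all _ fun t ht => ?_
      rw [uIoc_of_le hab] at ht
      exact hlim F hcF t (Ioc_subset_Icc_self ht)
  have key := tendsto_nhds_unique hL (hR.congr' (by
    filter_upwards [hev] with δ hδ
    refine (h.heatOp_sub_eq hw hF ha hab (by linarith [hδ.1]) hr ?_ hwg hFg).symm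
    refine le_trans ?_ hε1.le
    exact mul_le_mul_of_nonneg_left (by linarith [hδ.2]) hr1.le))
  rw [sub_self, heatOp_zero] at key
  linarith

theorem IsWeakSolution.hasCutoffIdentity {m p : ℝ} {w F : ℝ → ℝ → ℝ}
    (h : IsWeakSolution m p w F) (hw : Continuous (Function.uncurry w))
    (hF : Continuous (Function.uncurry F)) : HasCutoffIdentity m p w F :=
  fun _ _ _ _ ha hab hbS _ hχ hχc => heatKernel_cutoff_identity ha hab hbS hw hF h hχ hχc

theorem HasCutoffIdentity.sub {m p : ℝ} {w₁ w₂ F₁ F₂ : ℝ → ℝ → ℝ}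
    (h₁ : HasCutoffIdentity m p w₁ F₁) (h₂ : HasCutoffIdentity m p w₂ F₂)
    (hw₁ : Continuous (Function.uncurry w₁)) (hF₁ : Continuous (Function.uncurry F₁))
    (hw₂ : Continuous (Function.uncurry w₂)) (hF₂ : Continuous (Function.uncurry F₂)) :
    HasCutoffIdentity m p (fun t z => w₁ t z - w₂ t z) (fun t z => F₁ t z - F₂ t z) := by
  intro x S a b ha hab hbS χ hχ hχc
  set k : ℝ → ℝ → ℝ := fun t z => χ z * heatKernel m p x (S - t) z with hk
  set l : ℝ → ℝ → ℝ := fun t z => deriv (deriv χ) z * heatKernel m p x (S - t) z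
          + 2 * deriv χ z * heatKernelDeriv m p x (S - t) z
          - m * deriv χ z * heatKernel m p x (S - t) z with hl
  have hkc : ContinuousOn (Function.uncurry k) (Icc a b ×ˢ univ) :=
    (hχ.continuous.comp continuous_snd).continuousOn.mul (continuousOn_backward_heatKernel hbS)
  have hlc : ContinuousOn (Function.uncurry l) (Icc a b ×ˢ univ) :=
    continuousOn_cutoff_terms hbS hχ
  have hk0 : ∀ t, ∀ z ∉ tsupport χ, k t z = 0 := fun t z hz => by
    simp [hk, image_eq_zero_of_notMem_tsupport hz]
  have hl0 : ∀ t, ∀ z ∉ tsupport χ, l t z = 0 := fun t z hz => by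
    simp [hl, deriv_eq_zero_of_notMem_tsupport hz, deriv_deriv_eq_zero_of_notMem_tsupport hz]
  have hint : ∀ f g : ℝ → ℝ → ℝ, Continuous (Function.uncurry f) →
      ContinuousOn (Function.uncurry g) (Icc a b ×ˢ univ) →
      (∀ t, ∀ z ∉ tsupport χ, g t z = 0) → ∀ t ∈ Icc a b,
      Integrable fun z => f t z * g t z := fun f g hf hg hg0 t ht =>
    integrable_slice_of_continuousOn (f := fun t z => f t z * g t z) hχc.isCompact
      (hf.continuousOn.mul hg) (fun t z hz => by simp [hg0 t z hz]) ht
  have hcts : ∀ f g : ℝ → ℝ → ℝ, Continuous (Function.uncurry f) →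
      ContinuousOn (Function.uncurry g) (Icc a b ×ˢ univ) →
      (∀ t, ∀ z ∉ tsupport χ, g t z = 0) →
      ContinuousOn (fun t => ∫ z, f t z * g t z) (Icc a b) := fun f g hf hg hg0 =>
    continuousOn_integral_of_compact_support hχc.isCompact
      (f := fun t z => f t z * g t z) (hf.continuousOn.mul hg)
      fun t z _ hz => by simp [hg0 t z hz]
  have hsub : ∀ f₁ f₂ g : ℝ → ℝ → ℝ, Continuous (Function.uncurry f₁) →
      Continuous (Function.uncurry f₂) →
      ContinuousOn (Function.uncurry g) (Icc a b ×ˢ univ) →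
      (∀ t, ∀ z ∉ tsupport χ, g t z = 0) → ∀ t ∈ Icc a b,
      ∫ z, (f₁ t z - f₂ t z) * g t z = (∫ z, f₁ t z * g t z) - ∫ z, f₂ t z * g t z := by
    intro f₁ f₂ g hf₁ hf₂ hg hg0 t ht
    simp only [sub_mul]
    exact integral_sub (hint f₁ g hf₁ hg hg0 t ht) (hint f₂ g hf₂ hg hg0 t ht)
  have e₁ := h₁ x S a b ha hab hbS χ hχ hχc
  have e₂ := h₂ x S a b ha hab hbS χ hχ hχc
  have i₁ : IntervalIntegrable (fun t => (∫ z, F₁ t z * k t z) + ∫ z, w₁ t z * l t z)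
      volume a b := ContinuousOn.intervalIntegrable (by
    rw [uIcc_of_le hab]; exact (hcts F₁ k hF₁ hkc hk0).add (hcts w₁ l hw₁ hlc hl0))
  have i₂ : IntervalIntegrable (fun t => (∫ z, F₂ t z * k t z) + ∫ z, w₂ t z * l t z)
      volume a b := ContinuousOn.intervalIntegrable (by
    rw [uIcc_of_le hab]; exact (hcts F₂ k hF₂ hkc hk0).add (hcts w₂ l hw₂ hlc hl0))
  have eb := hsub w₁ w₂ k hw₁ hw₂ hkc hk0 b (right_mem_Icc.2 hab)
  have ea := hsub w₁ w₂ k hw₁ hw₂ hkc hk0 a (left_mem_Icc.2 hab)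
  have er : ∫ t in a..b, ((∫ z, (F₁ t z - F₂ t z) * k t z) + ∫ z, (w₁ t z - w₂ t z) * l t z)
      = (∫ t in a..b, ((∫ z, F₁ t z * k t z) + ∫ z, w₁ t z * l t z))
        - ∫ t in a..b, ((∫ z, F₂ t z * k t z) + ∫ z, w₂ t z * l t z) := by
    rw [← intervalIntegral.integral_sub i₁ i₂]
    refine intervalIntegral.integral_congr fun t ht => ?_
    rw [uIcc_of_le hab] at ht
    simp only [hsub F₁ F₂ k hF₁ hF₂ hkc hk0 t ht, hsub w₁ w₂ l hw₁ hw₂ hlc hl0 t ht]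
    ring
  simp only [hk, hl] at ea eb er
  rw [ea, eb, er, ← e₁, ← e₂]
  ring

/-- Continuation of a function of `t ≥ -h` to all times by its value at `t = -h`. It turns
functions continuous on `[-h, ∞) × ℝ` into functions continuous on the plane. -/
def extendTime (h : ℝ) (w : ℝ → ℝ → ℝ) (t z : ℝ) : ℝ := w (max t (-h)) z

theorem extendTime_of_le {h t : ℝ} (ht : -h ≤ t) (w : ℝ → ℝ → ℝ) : extendTime h w t = w t := by
  funext z
  rw [extendTime, max_eq_left ht]

theorem continuous_extendTime {h : ℝ} {w : ℝ → ℝ → ℝ}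
    (hw : ContinuousOn (Function.uncurry w) (Ici (-h) ×ˢ univ)) :
    Continuous (Function.uncurry (extendTime h w)) :=
  hw.comp_continuous (f := fun y : ℝ × ℝ => (max y.1 (-h), y.2)) (by fun_prop)
    fun y => ⟨le_max_right y.1 (-h), mem_univ _⟩

theorem IsDelayedSolution.isWeakSolution {h m p d : ℝ} (hh : 0 < h) {f : ℝ → ℝ}
    {w : ℝ → ℝ → ℝ} (hw : IsDelayedSolution h m p d f w) :
    IsWeakSolution m p (extendTime h w) fun t z => f (extendTime h w (t - h) (z + d)) := by
  intro φ h1 h2 h3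
  refine Eq.trans ?_ (hw.weak_eq φ h1 h2 h3)
  apply setIntegral_congr_fun measurableSet_Ioi
  intro t ht
  have ht' : (0 : ℝ) < t := ht
  simp only [extendTime_of_le (show -h ≤ t by linarith) w,
    extendTime_of_le (show -h ≤ t - h by linarith) w]

/-- `w` satisfies Duhamel's formula with source `F` on all sufficiently short intervals. The
admissible length may depend on the time horizon `T`, as the growth rate of `w` does. -/
def SatisfiesDuhamel (m p : ℝ) (w F : ℝ → ℝ → ℝ) : Prop :=
  ∀ T : ℝ, ∃ ε > 0, ∀ a b x : ℝ, 0 ≤ a → a ≤ b → b ≤ T → b - a ≤ ε →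
    w b x = heatOp m p (b - a) (w a) x + ∫ t in a..b, heatOp m p (b - t) (F t) x

/-- `w` satisfies Duhamel's formula with source `F` on all sufficiently short intervals, with all
integrals convergent. -/
def IsMildSolution (m p : ℝ) (w F : ℝ → ℝ → ℝ) : Prop :=
  ∀ T : ℝ, ∃ ε > 0, ∀ a b x : ℝ, 0 ≤ a → a ≤ b → b ≤ T → b - a ≤ ε →
    Integrable (w a) (heatMeasure m (b - a) x) ∧
    (∀ t ∈ Icc a b, Integrable (F t) (heatMeasure m (b - t) x)) ∧
    IntervalIntegrable (fun t => heatOp m p (b - t) (F t) x) volume a b ∧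
    w b x = heatOp m p (b - a) (w a) x + ∫ t in a..b, heatOp m p (b - t) (F t) x

theorem HasCutoffIdentity.isMildSolution {h m p d Λ : ℝ} {w F : ℝ → ℝ → ℝ} (hh : 0 ≤ h)
    (hcut : HasCutoffIdentity m p w F) (hw : Continuous (Function.uncurry w))
    (hF : Continuous (Function.uncurry F)) (hg : HasGaussianGrowth h w)
    (hFw : ∀ t, 0 ≤ t → ∀ z, |F t z| ≤ Λ * |w (t - h) (z + d)|) : IsMildSolution m p w F := by
  intro T
  obtain ⟨C, a, hC⟩ := hg T
  set r : ℝ := 2 * |a| with hr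
  have hr0 : 0 ≤ r := by positivity
  set C' : ℝ := |C| + |Λ| * (|C| * Real.exp (r * d ^ 2)) with hC'
  have hbase : ∀ t ∈ Icc (-h) T, ∀ z, |w t z| ≤ |C| * Real.exp (|a| * z ^ 2) := by
    intro t ht z
    refine (hC t ht z).trans ?_
    refine mul_le_mul (le_abs_self C) (Real.exp_le_exp.2 ?_) (Real.exp_pos _).le (abs_nonneg _)
    exact mul_le_mul_of_nonneg_right (le_abs_self a) (sq_nonneg z)
  have hwg : ∀ t ∈ Icc 0 T, ∀ z, |w t z| ≤ C' * Real.exp (r * z ^ 2) := by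
    intro t ht z
    refine (hbase t ⟨by linarith [ht.1], ht.2⟩ z).trans ?_
    refine mul_le_mul (le_add_of_nonneg_right (by positivity)) (Real.exp_le_exp.2 ?_)
      (Real.exp_pos _).le (by positivity)
    rw [hr]
    nlinarith [mul_nonneg (abs_nonneg a) (sq_nonneg z)]
  have hFg : ∀ t ∈ Icc 0 T, ∀ z, |F t z| ≤ C' * Real.exp (r * z ^ 2) := by
    intro t ht z
    have e1 : Real.exp (|a| * (z + d) ^ 2) ≤ Real.exp (r * d ^ 2) * Real.exp (r * z ^ 2) := by
      rw [← Real.exp_add]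
      apply Real.exp_le_exp.2
      rw [hr]
      nlinarith [mul_nonneg (abs_nonneg a) (sq_nonneg (z - d))]
    calc |F t z| ≤ Λ * |w (t - h) (z + d)| := hFw t ht.1 z
      _ ≤ |Λ| * |w (t - h) (z + d)| := by gcongr; exact le_abs_self Λ
      _ ≤ |Λ| * (|C| * Real.exp (|a| * (z + d) ^ 2)) := by
          gcongr
          exact hbase (t - h) ⟨by linarith [ht.1], by linarith [ht.2]⟩ _
      _ ≤ |Λ| * (|C| * (Real.exp (r * d ^ 2) * Real.exp (r * z ^ 2))) := by gcongr
      _ = (|Λ| * (|C| * Real.exp (r * d ^ 2))) * Real.exp (r * z ^ 2) := by ring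
      _ ≤ _ := by
          gcongr
          exact le_add_of_nonneg_left (abs_nonneg C)
  have hr1 : 0 < 32 * (r + 1) := by positivity
  refine ⟨1 / (32 * (r + 1)), by positivity, fun a b x ha hab hbT hε => ?_⟩
  have hab' : 32 * (r + 1) * (b - a) ≤ 1 := by
    rw [le_div_iff₀ hr1] at hε
    linarith
  have hba : 0 ≤ b - a := sub_nonneg.2 hab
  have hrba : 0 ≤ r * (b - a) := mul_nonneg hr0 hba
  have hsub : ∀ t ∈ Icc a b, t ∈ Icc 0 T := fun t ht => ⟨ha.trans ht.1, ht.2.trans hbT⟩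
  have hslice : ∀ f : ℝ → ℝ → ℝ, Continuous (Function.uncurry f) → ∀ t, Continuous (f t) :=
    fun f hf t => hf.comp (by fun_prop : Continuous fun z : ℝ => (t, z))
  have hε' : 16 * r * (b - a) ≤ 1 := by nlinarith
  refine ⟨integrable_heatMeasure hr0 hε' ⟨hba, le_rfl⟩ (hslice w hw a)
    (hwg a (hsub a (left_mem_Icc.2 hab))), fun t ht => integrable_heatMeasure hr0 hε'
    ⟨by linarith [ht.2], by linarith [ht.1]⟩ (hslice F hF t) (hFg t (hsub t ht)), ?_⟩
  exact hcut.duhamel hw hF ha hab hr0 (by nlinarith) (fun t ht => hwg t (hsub t ht))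
    (fun t ht => hFg t (hsub t ht)) x

/-! ### The exponential weight -/

/-- Multiplication by `e^{-lam z}` conjugates the generator `∂_zz - c ∂_z - 1` to
`∂_zz + (2 lam - c) ∂_z + (lam² - c lam - 1)`. -/
theorem weight_mul_heatOp (c lam x : ℝ) {τ : ℝ} (hτ : 0 ≤ τ) (f : ℝ → ℝ) :
    weight lam x * heatOp (-c) (-1) τ f x
      = heatOp (coefM c lam) (coefP c lam) τ (fun z => weight lam z * f z) x := by
  rcases hτ.eq_or_lt with rfl | hτ
  · simp only [heatOp_zero]
  rw [heatOp_eq_integral_heatKernel _ _ _ hτ, heatOp_eq_integral_heatKernel _ _ _ hτ,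
    ← integral_const_mul]
  refine integral_congr_ae (ae_of_all _ fun z => ?_)
  have key : weight lam x * heatKernel (-c) (-1) x τ z
      = weight lam z * heatKernel (coefM c lam) (coefP c lam) x τ z := by
    rw [weight, weight, heatKernel, heatKernel, ← Real.exp_add, ← Real.exp_add]
    congr 1
    rw [coefM, coefP]
    field_simp
    ring
  simp only []
  rw [mul_left_comm, key]
  ring

/-! ### Comparison -/

/-- A mild solution whose source is dominated by `q |w(t - h, z + d)|` stays below every mild
solution of the corresponding linear equation that dominates it initially. -/
theorem IsMildSolution.abs_le {h m p q d : ℝ} (hh : 0 < h) (hq : 0 ≤ q) {w F u : ℝ → ℝ → ℝ}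
    (hw : SatisfiesDuhamel m p w F)
    (hF : ∀ t, 0 ≤ t → ∀ z, |F t z| ≤ q * |w (t - h) (z + d)|)
    (hu : IsMildSolution m p u fun t z => q * u (t - h) (z + d))
    (h0 : ∀ t ∈ Icc (-h) 0, ∀ z, |w t z| ≤ u t z) {t : ℝ} (ht : -h ≤ t) (z : ℝ) :
    |w t z| ≤ u t z := by
  obtain ⟨ε₁, hε₁, H₁⟩ := hw t
  obtain ⟨ε₂, hε₂, H₂⟩ := hu t
  set ε := min (min ε₁ ε₂) h with hε
  have hε0 : 0 < ε := lt_min (lt_min hε₁ hε₂) hh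
  have key : ∀ n : ℕ, ∀ s ∈ Icc (-h) t, s ≤ n * ε → ∀ z, |w s z| ≤ u s z := by
    intro n
    induction n with
    | zero =>
      intro s hs hsn z
      exact h0 s ⟨hs.1, by simpa using hsn⟩ z
    | succ n ih =>
      intro b hb hbn x
      rcases le_or_gt b (n * ε) with hle | hlt
      · exact ih b hb hle x
      set a : ℝ := n * ε with ha
      have ha0 : 0 ≤ a := by positivity
      have hba : b - a ≤ ε := by
        push_cast at hbn
        linarith
      obtain ⟨i1, i2, i3, e2⟩ := H₂ a b x ha0 hlt.le hb.2
        (hba.trans ((min_le_left _ _).trans (min_le_right _ _)))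
      have e1 := H₁ a b x ha0 hlt.le hb.2
        (hba.trans ((min_le_left _ _).trans (min_le_left _ _)))
      have hheat : ∀ (τ : ℝ) (f g : ℝ → ℝ), Integrable g (heatMeasure m τ x) →
          (∀ z, |f z| ≤ g z) → |heatOp m p τ f x| ≤ heatOp m p τ g x := by
        intro τ f g hg hfg
        rw [heatOp, abs_mul, Real.abs_exp]
        exact mul_le_mul_of_nonneg_left
          (norm_integral_le_of_norm_le (f := f) hg (ae_of_all _ hfg)) (Real.exp_pos _).le
      rw [e1, e2]
      refine (abs_add_le _ _).trans (add_le_add ?_ ?_)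
      · exact hheat _ _ _ i1 (ih a ⟨by linarith, hlt.le.trans hb.2⟩ le_rfl)
      · refine intervalIntegral.norm_integral_le_of_norm_le
          (f := fun s => heatOp m p (b - s) (F s) x) hlt.le (ae_of_all _ fun s hs => ?_) i3
        have hs' := Ioc_subset_Icc_self hs
        refine hheat _ _ _ (i2 s hs') fun z => ?_
        refine (hF s (ha0.trans hs'.1) z).trans (mul_le_mul_of_nonneg_left ?_ hq)
        have hεh : ε ≤ h := min_le_right _ _
        exact ih (s - h) ⟨by linarith [hs'.1], by linarith [hs'.2, hb.2]⟩
          (by linarith [hs'.2]) _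
  obtain ⟨n, hn⟩ := exists_nat_ge (t / ε)
  exact key n t ⟨ht, le_rfl⟩ ((div_le_iff₀ hε0).1 hn) z

/-! ### Smoothing estimates for the delayed inequality -/

theorem lintegral_heatMeasure (m x : ℝ) {τ : ℝ} (hτ : 0 ≤ τ) {f : ℝ → ENNReal}
    (hf : Measurable f) :
    ∫⁻ z, f z ∂heatMeasure m τ x
      = ∫⁻ y, f (x + m * τ + √τ * y) ∂ProbabilityTheory.gaussianReal 0 2 := by
  rw [heatMeasure_eq_map m x hτ, lintegral_map hf (by fun_prop)]

theorem measurable_lintegral_heatMeasure (m : ℝ) {τ : ℝ} (hτ : 0 ≤ τ) {f : ℝ → ENNReal}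
    (hf : Measurable f) : Measurable fun x => ∫⁻ z, f z ∂heatMeasure m τ x := by
  simp only [lintegral_heatMeasure m _ hτ hf]
  exact (hf.comp (by fun_prop : Measurable fun r : ℝ × ℝ =>
    r.1 + m * τ + √τ * r.2)).lintegral_prod_right'

theorem lintegral_heatMeasure_shift (m τ x d : ℝ) {f : ℝ → ENNReal} (hf : Measurable f) :
    ∫⁻ z, f (z + d) ∂heatMeasure m τ x = ∫⁻ z, f z ∂heatMeasure m τ (x + d) := by
  have : heatMeasure m τ (x + d) = (heatMeasure m τ x).map (· + d) := by
    rw [heatMeasure, heatMeasure, ProbabilityTheory.gaussianReal_map_add_const]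
    congr 1
    ring
  rw [this, lintegral_map hf (by fun_prop)]

/-- The semigroup property of the Gaussian measures. -/
theorem lintegral_heatMeasure_heatMeasure (m x : ℝ) {s τ : ℝ} (hs : 0 ≤ s) (hτ : 0 ≤ τ)
    {f : ℝ → ENNReal} (hf : Measurable f) :
    ∫⁻ y, ∫⁻ z, f z ∂heatMeasure m τ y ∂heatMeasure m s x
      = ∫⁻ z, f z ∂heatMeasure m (s + τ) x := by
  have h1 : ∀ y, heatMeasure m τ y
      = (ProbabilityTheory.gaussianReal (m * τ) (2 * τ).toNNReal).map (y + ·) := by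
    intro y
    rw [ProbabilityTheory.gaussianReal_map_const_add, heatMeasure, add_comm]
  have h2 : heatMeasure m (s + τ) x
      = Measure.conv (heatMeasure m s x)
        (ProbabilityTheory.gaussianReal (m * τ) (2 * τ).toNNReal) := by
    rw [heatMeasure, heatMeasure, ProbabilityTheory.gaussianReal_conv_gaussianReal]
    congr 1
    · ring
    · ext
      push_cast
      rw [Real.coe_toNNReal _ (by positivity), Real.coe_toNNReal _ (by positivity),
        Real.coe_toNNReal _ (by positivity)]
      ring
  rw [h2, Measure.lintegral_conv hf]
  refine lintegral_congr fun y => ?_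
  rw [h1, lintegral_map hf (by fun_prop)]

/-- The `L¹ → L^∞` smoothing of the heat semigroup. -/
theorem lintegral_heatMeasure_le (m x : ℝ) {s : ℝ} (hs : 0 < s) (f : ℝ → ENNReal)
    (hf : Measurable f) :
    ∫⁻ z, f z ∂heatMeasure m s x ≤ ENNReal.ofReal (√(4 * Real.pi * s))⁻¹ * ∫⁻ z, f z := by
  have hv : (2 * s).toNNReal ≠ 0 := by simpa using hs
  rw [heatMeasure, ProbabilityTheory.gaussianReal_of_var_ne_zero _ hv,
    lintegral_withDensity_eq_lintegral_mul _ (ProbabilityTheory.measurable_gaussianPDF _ _) hf,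
    ← lintegral_const_mul _ hf]
  refine lintegral_mono fun z => ?_
  simp only [Pi.mul_apply]
  gcongr
  rw [ProbabilityTheory.gaussianPDF_def]
  refine ENNReal.ofReal_le_ofReal ?_
  rw [ProbabilityTheory.gaussianPDFReal_def]
  simp only [Real.coe_toNNReal (2 * s) (by positivity)]
  rw [show 2 * Real.pi * (2 * s) = 4 * Real.pi * s by ring]
  refine mul_le_of_le_one_right (by positivity) (Real.exp_le_one_iff.2 ?_)
  rw [neg_div]
  exact neg_nonpos.2 (by positivity)

/-- The superposition of Gaussians in frequency space that represents the peak of the heat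
kernel. -/
theorem lintegral_exp_neg_sq_mul {s : ℝ} (hs : 0 < s) :
    ∫⁻ ζ in Ioi (0 : ℝ), ENNReal.ofReal (Real.pi⁻¹ * Real.exp (-(ζ ^ 2 * s)))
      = ENNReal.ofReal (√(4 * Real.pi * s))⁻¹ := by
  have hpi := Real.pi_pos
  have hint : Integrable (fun ζ : ℝ => Real.pi⁻¹ * Real.exp (-(ζ ^ 2 * s)))
      (volume.restrict (Ioi 0)) := by
    refine Integrable.const_mul ?_ _
    have := (integrable_exp_neg_mul_sq hs).integrableOn (s := Ioi 0)
    refine this.congr (ae_of_all _ fun ζ => ?_)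
    simp only []
    congr 1
    ring
  rw [← ofReal_integral_eq_lintegral_ofReal hint (ae_of_all _ fun ζ => by positivity),
    integral_const_mul]
  congr 1
  have h1 : ∫ ζ in Ioi (0 : ℝ), Real.exp (-(ζ ^ 2 * s)) = √(Real.pi / s) / 2 := by
    rw [← integral_gaussian_Ioi s]
    refine integral_congr_ae (ae_of_all _ fun ζ => ?_)
    simp only []
    congr 1
    ring
  rw [h1, Real.sqrt_div hpi.le, Real.sqrt_mul (by positivity), Real.sqrt_mul (by positivity),
    show (4 : ℝ) = 2 ^ 2 by norm_num, Real.sqrt_sq (by norm_num)]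
  have hp2 : √Real.pi * √Real.pi = Real.pi := Real.mul_self_sqrt hpi.le
  have : 0 < √Real.pi := Real.sqrt_pos.2 hpi
  have : 0 < √s := Real.sqrt_pos.2 hs
  field_simp
  linarith [hp2, sq (√Real.pi)]

/-- Transfer of a family of bounds `β t s` on the Gaussian averages (over time `s`) of `|w t ·|`
from the initial interval to positive times, when `β` is a supersolution of the delayed Duhamel
inequality. -/
theorem lintegral_heatMeasure_le_of_supersolution {h m p q d T : ℝ} (hh : 0 < h) (hq : 0 ≤ q)
    {w F : ℝ → ℝ → ℝ} (hwc : Continuous (Function.uncurry w))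
    (hw : SatisfiesDuhamel m p w F)
    (hF : ∀ t, 0 ≤ t → ∀ z, |F t z| ≤ q * |w (t - h) (z + d)|) {β : ℝ → ℝ → ENNReal}
    (h0 : ∀ t ∈ Icc (-h) 0, ∀ s, 0 < s → ∀ x, ∫⁻ z, ‖w t z‖ₑ ∂heatMeasure m s x ≤ β t s)
    (hstep : ∀ a b s, 0 ≤ a → a < b → b ≤ T → 0 ≤ s →
      ENNReal.ofReal (Real.exp (p * (b - a))) * β a (s + (b - a))
        + ∫⁻ t in Ioo a b, ENNReal.ofReal (q * Real.exp (p * (b - t))) * β (t - h) (s + (b - t))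
      ≤ β b s) {t : ℝ} (ht : t ∈ Ioc 0 T) {s : ℝ} (hs : 0 ≤ s) (x : ℝ) :
    ∫⁻ z, ‖w t z‖ₑ ∂heatMeasure m s x ≤ β t s := by
  obtain ⟨ε₁, hε₁, H⟩ := hw T
  set ε := min ε₁ h with hε
  have hε0 : 0 < ε := lt_min hε₁ hh
  have hslice : ∀ t, Measurable fun z => ‖w t z‖ₑ := fun t =>
    (hwc.comp (by fun_prop : Continuous fun z : ℝ => (t, z))).measurable.enorm
  have hheat : ∀ τ f y, ‖heatOp m p τ f y‖ₑ
      ≤ ENNReal.ofReal (Real.exp (p * τ)) * ∫⁻ z, ‖f z‖ₑ ∂heatMeasure m τ y := by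
    intro τ f y
    rw [heatOp, enorm_mul, Real.enorm_of_nonneg (Real.exp_pos _).le]
    gcongr
    exact enorm_integral_le_lintegral_enorm _
  have key : ∀ n : ℕ, ∀ t ∈ Ioc 0 T, t ≤ n * ε → ∀ s, 0 ≤ s → ∀ x,
      ∫⁻ z, ‖w t z‖ₑ ∂heatMeasure m s x ≤ β t s := by
    intro n
    induction n with
    | zero =>
      intro t ht htn
      exact absurd ht.1 (not_lt.2 (by simpa using htn))
    | succ n ih =>
      intro b hb hbn s hs x
      rcases le_or_gt b (n * ε) with hle | hlt
      · exact ih b hb hle s hs x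
      set a : ℝ := n * ε with ha
      have ha0 : 0 ≤ a := by positivity
      have hba : b - a ≤ ε := by
        push_cast at hbn
        linarith
      have hba0 : 0 < b - a := sub_pos.2 hlt
      have hεh : ε ≤ h := min_le_right _ _
      -- all times up to `a` are covered, at positive averaging times
      have hpast : ∀ t ∈ Icc (-h) a, ∀ s, 0 < s → ∀ x,
          ∫⁻ z, ‖w t z‖ₑ ∂heatMeasure m s x ≤ β t s := by
        intro t ht s hs x
        rcases le_or_gt t 0 with h1 | h1
        · exact h0 t ⟨ht.1, h1⟩ s hs x
        · exact ih t ⟨h1, by linarith [ht.2, hb.2]⟩ ht.2 s hs.le x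
      set P : ℝ → ℝ → ENNReal := fun t y => ∫⁻ u,
        ‖w (t - h) (y + d + m * (b - t) + √(b - t) * u)‖ₑ
          ∂ProbabilityTheory.gaussianReal 0 2 with hP
      have hPe : ∀ t ∈ Ioo a b, ∀ y, P t y
          = ∫⁻ z, ‖w (t - h) z‖ₑ ∂heatMeasure m (b - t) (y + d) := fun t ht y =>
        (lintegral_heatMeasure m (y + d) (sub_nonneg.2 ht.2.le) (hslice (t - h))).symm
      have hPm : Measurable (Function.uncurry P) := by
        have hc : Continuous fun r : (ℝ × ℝ) × ℝ =>
            w (r.1.1 - h) (r.1.2 + d + m * (b - r.1.1) + √(b - r.1.1) * r.2) :=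
          hwc.comp (f := fun r : (ℝ × ℝ) × ℝ =>
            (r.1.1 - h, r.1.2 + d + m * (b - r.1.1) + √(b - r.1.1) * r.2)) (by fun_prop)
        exact hc.measurable.enorm.lintegral_prod_right'
      have hone : ∀ y, ‖w b y‖ₑ ≤ ENNReal.ofReal (Real.exp (p * (b - a)))
          * (∫⁻ z, ‖w a z‖ₑ ∂heatMeasure m (b - a) y)
          + ∫⁻ t in Ioo a b, ENNReal.ofReal (q * Real.exp (p * (b - t))) * P t y := by
        intro y
        rw [H a b y ha0 hlt.le hb.2 (hba.trans (min_le_left _ _))]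
        refine (enorm_add_le _ _).trans (add_le_add (hheat _ _ _) ?_)
        rw [intervalIntegral.integral_of_le hlt.le, integral_Ioc_eq_integral_Ioo]
        refine (enorm_integral_le_lintegral_enorm _).trans
          (setLIntegral_mono' measurableSet_Ioo fun t ht => (hheat _ _ _).trans ?_)
        rw [hPe t ht, mul_comm q, ENNReal.ofReal_mul (Real.exp_pos _).le, mul_assoc]
        gcongr
        rw [← lintegral_heatMeasure_shift m (b - t) y d (hslice (t - h)),
          ← lintegral_const_mul _ (f := fun z => ‖w (t - h) (z + d)‖ₑ)
            ((hslice (t - h)).comp (measurable_add_const d))]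
        refine lintegral_mono fun z => ?_
        rw [Real.enorm_eq_ofReal_abs, Real.enorm_eq_ofReal_abs, ← ENNReal.ofReal_mul hq]
        exact ENNReal.ofReal_le_ofReal (hF t (ha0.trans ht.1.le) z)
      calc ∫⁻ y, ‖w b y‖ₑ ∂heatMeasure m s x
          ≤ ∫⁻ y, (ENNReal.ofReal (Real.exp (p * (b - a)))
            * (∫⁻ z, ‖w a z‖ₑ ∂heatMeasure m (b - a) y)
            + ∫⁻ t in Ioo a b, ENNReal.ofReal (q * Real.exp (p * (b - t))) * P t y)
              ∂heatMeasure m s x := lintegral_mono hone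
        _ = ENNReal.ofReal (Real.exp (p * (b - a)))
              * (∫⁻ z, ‖w a z‖ₑ ∂heatMeasure m (s + (b - a)) x)
            + ∫⁻ t in Ioo a b, ENNReal.ofReal (q * Real.exp (p * (b - t)))
              * ∫⁻ y, P t y ∂heatMeasure m s x := by
          have hm := measurable_lintegral_heatMeasure m hba0.le (hslice a)
          rw [lintegral_add_left (hm.const_mul _), lintegral_const_mul _ hm,
            lintegral_heatMeasure_heatMeasure m x hs hba0.le (hslice a)]
          congr 1
          rw [lintegral_lintegral_swap]
          · refine lintegral_congr fun t => lintegral_const_mul _ ?_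
            exact hPm.comp measurable_prodMk_left
          · refine Measurable.aemeasurable ?_
            exact Measurable.mul (by fun_prop) (hPm.comp measurable_swap)
        _ ≤ ENNReal.ofReal (Real.exp (p * (b - a))) * β a (s + (b - a))
            + ∫⁻ t in Ioo a b, ENNReal.ofReal (q * Real.exp (p * (b - t)))
              * β (t - h) (s + (b - t)) := by
          refine add_le_add ?_ (setLIntegral_mono' measurableSet_Ioo fun t ht => ?_)
          · gcongr
            exact hpast a ⟨by linarith, le_rfl⟩ _ (by linarith) x
          · gcongr
            simp only [hPe t ht]
            rw [lintegral_heatMeasure_shift m s x d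
              (f := fun y => ∫⁻ z, ‖w (t - h) z‖ₑ ∂heatMeasure m (b - t) y) ?_,
              lintegral_heatMeasure_heatMeasure m _ hs (sub_nonneg.2 ht.2.le) (hslice _)]
            · exact hpast (t - h) ⟨by linarith [ht.1], by linarith [ht.2]⟩ _
                (by linarith [ht.2]) _
            · exact measurable_lintegral_heatMeasure m (sub_nonneg.2 ht.2.le) (hslice _)
        _ ≤ β b s := hstep a b s ha0 hlt hb.2 hs
  obtain ⟨n, hn⟩ := exists_nat_ge (t / ε)
  exact key n t ht ((div_le_iff₀ hε0).1 hn) s hs x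

/-- Variation of constants for a scalar differential inequality `D ≥ l β + q f`. -/
theorem exp_mul_add_lintegral_le {q l a b : ℝ} (hq : 0 ≤ q) (hab : a < b) {β D f : ℝ → ℝ}
    (hβa : 0 ≤ β a) (hf0 : ∀ t, 0 ≤ f t) (hf : IntegrableOn f (Icc a b))
    (hcont : ContinuousOn β (Icc a b)) (hder : ∀ t ∈ Ioo a b, HasDerivAt β (D t) t)
    (hineq : ∀ t ∈ Ioo a b, q * f t ≤ D t - l * β t) :
    ENNReal.ofReal (Real.exp (l * (b - a)) * β a)
      + ∫⁻ t in Ioo a b, ENNReal.ofReal (q * Real.exp (l * (b - t)) * f t)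
    ≤ ENNReal.ofReal (β b) := by
  have hφ : IntegrableOn (fun t => q * Real.exp (l * (b - t)) * f t) (Icc a b) :=
    hf.continuousOn_mul (by fun_prop) isCompact_Icc
  have key := intervalIntegral.integral_le_sub_of_hasDeriv_right_of_le (a := a) (b := b)
    (g := fun t => Real.exp (l * (b - t)) * β t)
    (g' := fun t => Real.exp (l * (b - t)) * (D t - l * β t))
    (φ := fun t => q * Real.exp (l * (b - t)) * f t) hab.le
    (ContinuousOn.mul (by fun_prop) hcont) (fun t ht => ?_) hφ (fun t ht => ?_)
  · have e1 : ∫⁻ t in Ioo a b, ENNReal.ofReal (q * Real.exp (l * (b - t)) * f t)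
        = ENNReal.ofReal (∫ t in a..b, q * Real.exp (l * (b - t)) * f t) := by
      rw [intervalIntegral.integral_of_le hab.le, integral_Ioc_eq_integral_Ioo]
      refine (ofReal_integral_eq_lintegral_ofReal (hφ.mono_set Ioo_subset_Icc_self)
        (ae_of_all _ fun t => ?_)).symm
      have := hf0 t
      simp only [Pi.zero_apply]
      positivity
    have e2 : 0 ≤ ∫ t in a..b, q * Real.exp (l * (b - t)) * f t :=
      intervalIntegral.integral_nonneg hab.le fun t _ => by
        have := hf0 t
        positivity
    rw [e1, ← ENNReal.ofReal_add (by positivity) e2]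
    refine ENNReal.ofReal_le_ofReal ?_
    simp only [sub_self, mul_zero, Real.exp_zero, one_mul] at key
    linarith
  · have h1 : HasDerivAt (fun t : ℝ => Real.exp (l * (b - t)))
        (Real.exp (l * (b - t)) * (-l)) t := by
      have := (((hasDerivAt_id t).const_sub b).const_mul l).exp
      simpa using this
    refine ((h1.mul (hder t ht)).congr_deriv ?_).hasDerivWithinAt
    ring
  · calc q * Real.exp (l * (b - t)) * f t = Real.exp (l * (b - t)) * (q * f t) := by ring
      _ ≤ _ := mul_le_mul_of_nonneg_left (hineq t ht) (Real.exp_pos _).le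

/-- A pointwise bound from a family, indexed by frequencies `ζ`, of supersolutions of the scalar
delay equations `β' = (p - ζ²) β + q β(t - h)` that are at least `1` on the initial interval.
Frequency space enters only through the representation of Gaussian peaks as superpositions of the
functions `e^{-ζ² s}`, so that no Fourier transform of the solution is needed. -/
theorem enorm_le_of_frequency_supersolution {h m p q d T M : ℝ} (hh : 0 < h) (hq : 0 ≤ q)
    {w F : ℝ → ℝ → ℝ} (hwc : Continuous (Function.uncurry w))
    (hw : SatisfiesDuhamel m p w F)
    (hF : ∀ t, 0 ≤ t → ∀ z, |F t z| ≤ q * |w (t - h) (z + d)|)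
    (hL1 : ∀ t ∈ Icc (-h) 0, ∫⁻ z, ‖w t z‖ₑ ≤ ENNReal.ofReal M)
    {β D : ℝ → ℝ → ℝ} (hβm : Measurable (Function.uncurry β)) (hβ0 : ∀ ζ t, 0 ≤ β ζ t)
    (h1 : ∀ ζ, ∀ t ∈ Icc (-h) 0, 1 ≤ β ζ t)
    (hint : ∀ ζ, IntegrableOn (fun t => β ζ (t - h)) (Icc 0 T))
    (hcont : ∀ ζ, ContinuousOn (β ζ) (Icc 0 T))
    (hder : ∀ ζ, ∀ t ∈ Ioo 0 T, HasDerivAt (β ζ) (D ζ t) t)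
    (hineq : ∀ ζ, ∀ t ∈ Ioo 0 T, q * β ζ (t - h) ≤ D ζ t - (p - ζ ^ 2) * β ζ t)
    {t : ℝ} (ht : t ∈ Ioc 0 T) (x : ℝ) :
    ‖w t x‖ₑ ≤ ENNReal.ofReal M * ∫⁻ ζ in Ioi (0 : ℝ), ENNReal.ofReal (Real.pi⁻¹ * β ζ t) := by
  have hpi := Real.pi_pos
  set k : ℝ → ℝ → ℝ → ℝ := fun t s ζ => Real.pi⁻¹ * Real.exp (-(ζ ^ 2 * s)) * β ζ t with hk
  have hkm : ∀ t s, Measurable fun ζ => ENNReal.ofReal (k t s ζ) := fun t s =>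
    (Measurable.mul (by fun_prop) (hβm.comp (measurable_id.prodMk measurable_const))).ennreal_ofReal
  have hslice : ∀ t, Measurable fun z => ‖w t z‖ₑ := fun t =>
    (hwc.comp (by fun_prop : Continuous fun z : ℝ => (t, z))).measurable.enorm
  have key := lintegral_heatMeasure_le_of_supersolution hh hq hwc hw hF (T := T)
    (β := fun t s => ENNReal.ofReal M * ∫⁻ ζ in Ioi (0 : ℝ), ENNReal.ofReal (k t s ζ)) ?_ ?_ ht
    le_rfl x
  · have e1 : heatMeasure m 0 x = Measure.dirac x := by simp [heatMeasure]
    rw [e1, lintegral_dirac' _ (hslice t)] at key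
    simpa [hk] using key
  · intro t ht s hs x
    refine (lintegral_heatMeasure_le m x hs _ (hslice t)).trans ?_
    rw [mul_comm, ← lintegral_exp_neg_sq_mul hs]
    refine mul_le_mul' (hL1 t ht) (lintegral_mono fun ζ => ENNReal.ofReal_le_ofReal ?_)
    exact le_mul_of_one_le_right (by positivity) (h1 ζ t ht)
  · intro a b s ha hab hbT hs
    have hIcc : Icc a b ⊆ Icc 0 T := Icc_subset_Icc ha hbT
    have hIoo : Ioo a b ⊆ Ioo 0 T := Ioo_subset_Ioo ha hbT
    have hkm2 : Measurable (Function.uncurry fun t ζ =>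
        ENNReal.ofReal (q * Real.exp (p * (b - t))) * ENNReal.ofReal (k (t - h) (s + (b - t)) ζ)) := by
      refine Measurable.mul (by fun_prop) (Measurable.ennreal_ofReal ?_)
      refine Measurable.mul (by fun_prop) ?_
      exact hβm.comp (by fun_prop : Measurable fun r : ℝ × ℝ => (r.2, r.1 - h))
    have e2 : ∫⁻ t in Ioo a b, ENNReal.ofReal (q * Real.exp (p * (b - t))) * (ENNReal.ofReal M
          * ∫⁻ ζ in Ioi (0 : ℝ), ENNReal.ofReal (k (t - h) (s + (b - t)) ζ))
        = ENNReal.ofReal M * ∫⁻ ζ in Ioi (0 : ℝ), ∫⁻ t in Ioo a b,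
          ENNReal.ofReal (q * Real.exp (p * (b - t)))
            * ENNReal.ofReal (k (t - h) (s + (b - t)) ζ) := by
      simp only [mul_left_comm _ (ENNReal.ofReal M)]
      rw [lintegral_const_mul' _ _ ENNReal.ofReal_ne_top, ← lintegral_lintegral_swap
        (μ := volume.restrict (Ioo a b)) (ν := volume.restrict (Ioi (0 : ℝ))) hkm2.aemeasurable]
      simp only [lintegral_const_mul' _ _ ENNReal.ofReal_ne_top]
    rw [e2, mul_left_comm, ← mul_add, ← lintegral_const_mul' _ _ ENNReal.ofReal_ne_top,
      ← lintegral_add_left ((hkm a _).const_mul _)]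
    gcongr with ζ
    have hscal := exp_mul_add_lintegral_le (l := p - ζ ^ 2) hq hab (β := β ζ) (D := D ζ)
      (f := fun t => β ζ (t - h)) (hβ0 ζ a) (fun t => hβ0 ζ _) ((hint ζ).mono_set hIcc)
      ((hcont ζ).mono hIcc) (fun t ht => hder ζ t (hIoo ht)) (fun t ht => hineq ζ t (hIoo ht))
    have hc0 : 0 ≤ Real.pi⁻¹ * Real.exp (-(ζ ^ 2 * s)) := by positivity
    have e3 : ENNReal.ofReal (Real.exp (p * (b - a))) * ENNReal.ofReal (k a (s + (b - a)) ζ)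
        = ENNReal.ofReal (Real.pi⁻¹ * Real.exp (-(ζ ^ 2 * s)))
          * ENNReal.ofReal (Real.exp ((p - ζ ^ 2) * (b - a)) * β ζ a) := by
      rw [← ENNReal.ofReal_mul (Real.exp_pos _).le, ← ENNReal.ofReal_mul hc0]
      congr 1
      have : Real.exp (p * (b - a)) * Real.exp (-(ζ ^ 2 * (s + (b - a))))
          = Real.exp (-(ζ ^ 2 * s)) * Real.exp ((p - ζ ^ 2) * (b - a)) := by
        rw [← Real.exp_add, ← Real.exp_add]
        congr 1
        ring
      simp only [hk]
      linear_combination (Real.pi⁻¹ * β ζ a) * this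
    have e4 : ∀ t, ENNReal.ofReal (q * Real.exp (p * (b - t)))
          * ENNReal.ofReal (k (t - h) (s + (b - t)) ζ)
        = ENNReal.ofReal (Real.pi⁻¹ * Real.exp (-(ζ ^ 2 * s)))
          * ENNReal.ofReal (q * Real.exp ((p - ζ ^ 2) * (b - t)) * β ζ (t - h)) := by
      intro t
      rw [← ENNReal.ofReal_mul (by positivity), ← ENNReal.ofReal_mul hc0]
      congr 1
      have : Real.exp (p * (b - t)) * Real.exp (-(ζ ^ 2 * (s + (b - t))))
          = Real.exp (-(ζ ^ 2 * s)) * Real.exp ((p - ζ ^ 2) * (b - t)) := by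
        rw [← Real.exp_add, ← Real.exp_add]
        congr 1
        ring
      simp only [hk]
      linear_combination (Real.pi⁻¹ * q * β ζ (t - h)) * this
    simp only [e3, e4]
    rw [lintegral_const_mul' _ _ ENNReal.ofReal_ne_top, ← mul_add]
    refine (mul_le_mul' le_rfl hscal).trans_eq ?_
    rw [← ENNReal.ofReal_mul hc0]

/-! ### The decay estimate -/

theorem lintegral_inv_one_add_mul_sq {b : ℝ} (hb : 0 < b) :
    ∫⁻ ζ in Ioi (0 : ℝ), ENNReal.ofReal (Real.pi⁻¹ * (1 + b * ζ ^ 2)⁻¹)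
      = ENNReal.ofReal ((2 * √b)⁻¹) := by
  have hpi := Real.pi_pos
  have hsb : 0 < √b := Real.sqrt_pos.2 hb
  have hfun : (fun ζ : ℝ => (1 + b * ζ ^ 2)⁻¹) = fun ζ => (1 + (√b * ζ) ^ 2)⁻¹ := by
    funext ζ
    rw [mul_pow, Real.sq_sqrt hb.le]
  have hint : Integrable fun ζ : ℝ => (1 + b * ζ ^ 2)⁻¹ := by
    rw [hfun]
    exact integrable_inv_one_add_sq.comp_mul_left' hsb.ne'
  have hval : ∫ ζ in Ioi (0 : ℝ), (1 + b * ζ ^ 2)⁻¹ = (√b)⁻¹ * (Real.pi / 2) := by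
    rw [hfun, integral_comp_mul_left_Ioi (fun x : ℝ => (1 + x ^ 2)⁻¹) 0 hsb, mul_zero,
      integral_Ioi_inv_one_add_sq]
    simp
  rw [← ofReal_integral_eq_lintegral_ofReal (hint.integrableOn.const_mul _)
    (ae_of_all _ fun ζ => by positivity), integral_const_mul, hval]
  congr 1
  field_simp

theorem exp_neg_div_sqrt_pi_add_sqrt_le {y : ℝ} (hy : 0 ≤ y) :
    Real.exp (-y) / √Real.pi + √y ≤ √(1 + y) := by
  have hpi := Real.pi_gt_three
  have hsp : 0 < √Real.pi := Real.sqrt_pos.2 Real.pi_pos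
  have hsp2 : √Real.pi ^ 2 = Real.pi := Real.sq_sqrt Real.pi_pos.le
  have hsy : √y ^ 2 = y := Real.sq_sqrt hy
  have hsy0 := Real.sqrt_nonneg y
  have he0 := Real.exp_pos (-y)
  have he1 : Real.exp (-y) ≤ 1 := Real.exp_le_one_iff.2 (by linarith)
  -- `2 √y ≤ 1 + y ≤ e^y`
  have he2 : 2 * (Real.exp (-y) * √y) ≤ 1 := by
    have h1 : 2 * √y ≤ Real.exp y := by
      nlinarith [Real.add_one_le_exp y, sq_nonneg (√y - 1)]
    have h2 : Real.exp (-y) * Real.exp y = 1 := by rw [← Real.exp_add]; simp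
    nlinarith [mul_le_mul_of_nonneg_left h1 he0.le]
  set e := Real.exp (-y) / √Real.pi with he
  have hes : e * √Real.pi = Real.exp (-y) := by rw [he]; field_simp
  have h17 : 1.7 ≤ √Real.pi := by
    apply Real.le_sqrt_of_sq_le
    linarith
  have hee : e ≤ 10 / 17 := by
    rw [he, div_le_iff₀ hsp]
    nlinarith
  have he0' : 0 ≤ e := by positivity
  have hey : 2 * (e * √y) ≤ 10 / 17 := by
    have : 2 * (e * √y) = 2 * (Real.exp (-y) * √y) / √Real.pi := by rw [he]; ring
    rw [this, div_le_iff₀ hsp]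
    nlinarith
  apply Real.le_sqrt_of_sq_le
  nlinarith

/-- For `t ≥ h`, the supersolutions `e^{γ t} (1 + a ζ²)^{-t / h}`, `a = h / (1 + h (γ - p))`, give
the decay rate; Bernoulli's inequality turns them into the integrand of the arctangent. -/
theorem enorm_le_of_le_time {h m p q d γ M : ℝ} (hh : 0 < h) (hq : 0 < q) (hγ0 : γ ≤ 0)
    (hγ : γ - p = q * Real.exp (-(h * γ))) {w F : ℝ → ℝ → ℝ}
    (hwc : Continuous (Function.uncurry w))
    (hw : SatisfiesDuhamel m p w F)
    (hF : ∀ t, 0 ≤ t → ∀ z, |F t z| ≤ q * |w (t - h) (z + d)|)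
    (hL1 : ∀ t ∈ Icc (-h) 0, ∫⁻ z, ‖w t z‖ₑ ≤ ENNReal.ofReal M) {t : ℝ} (ht : h ≤ t) (x : ℝ) :
    ‖w t x‖ₑ ≤ ENNReal.ofReal M * ENNReal.ofReal
      (√(1 + h * (γ - p)) / 2 * (Real.exp (γ * t) / √t)) := by
  have hκ : 0 < γ - p := by rw [hγ]; positivity
  have ht0 : 0 < t := hh.trans_le ht
  set κ := γ - p with hκd
  set a := h / (1 + h * κ) with ha
  have hden : 0 < 1 + h * κ := by positivity
  have ha0 : 0 < a := by positivity
  have haκ : a * κ + a / h = 1 := by rw [ha]; field_simp; ring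
  set r : ℝ → ℝ := fun ζ => γ - Real.log (1 + a * ζ ^ 2) / h with hr
  have hbase : ∀ ζ : ℝ, 1 ≤ 1 + a * ζ ^ 2 := fun ζ => by
    have := mul_nonneg ha0.le (sq_nonneg ζ)
    linarith
  have hlog0 : ∀ ζ : ℝ, 0 ≤ Real.log (1 + a * ζ ^ 2) := fun ζ => Real.log_nonneg (hbase ζ)
  have hlog1 : ∀ ζ : ℝ, Real.log (1 + a * ζ ^ 2) ≤ a * ζ ^ 2 := fun ζ => by
    have := Real.log_le_sub_one_of_pos (lt_of_lt_of_le one_pos (hbase ζ))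
    linarith
  have hr0 : ∀ ζ, r ζ ≤ 0 := fun ζ => by
    have := div_nonneg (hlog0 ζ) hh.le
    simp only [hr]; linarith
  have hc : Continuous r := by
    simp only [hr]
    refine continuous_const.sub (Continuous.div_const (Continuous.log (by fun_prop) ?_) _)
    exact fun ζ => (lt_of_lt_of_le one_pos (hbase ζ)).ne'
  have key := enorm_le_of_frequency_supersolution hh hq.le hwc hw hF hL1 (T := t)
    (β := fun ζ t => Real.exp (r ζ * t)) (D := fun ζ t => r ζ * Real.exp (r ζ * t))
    (Continuous.measurable (by fun_prop)) (fun ζ t => (Real.exp_pos _).le)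
    (fun ζ t ht => Real.one_le_exp (mul_nonneg_of_nonpos_of_nonpos (hr0 ζ) ht.2))
    (fun ζ => Continuous.integrableOn_Icc (by fun_prop)) (fun ζ => by fun_prop) ?_ ?_
    (right_mem_Ioc.2 ht0) x
  · refine key.trans (mul_le_mul' le_rfl ?_)
    set b := t / (1 + h * κ) with hb
    have hb0 : 0 < b := by positivity
    have hle : ∀ ζ : ℝ, Real.pi⁻¹ * Real.exp (r ζ * t)
        ≤ Real.exp (γ * t) * (Real.pi⁻¹ * (1 + b * ζ ^ 2)⁻¹) := by
      intro ζ
      have hpi := Real.pi_pos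
      have e1 : Real.exp (r ζ * t) = Real.exp (γ * t) * ((1 + a * ζ ^ 2) ^ (t / h))⁻¹ := by
        rw [Real.rpow_def_of_pos (lt_of_lt_of_le one_pos (hbase ζ)), ← Real.exp_neg,
          ← Real.exp_add]
        congr 1
        simp only [hr]
        field_simp
        ring
      have e2 : 1 + b * ζ ^ 2 ≤ (1 + a * ζ ^ 2) ^ (t / h) := by
        have := one_add_mul_self_le_rpow_one_add (s := a * ζ ^ 2) (by linarith [hbase ζ])
          (p := t / h) (by rwa [le_div_iff₀ hh, one_mul])
        refine le_trans (le_of_eq ?_) this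
        rw [hb, ha]
        field_simp
      have e3 : 0 < 1 + b * ζ ^ 2 := by positivity
      rw [e1, mul_left_comm]
      gcongr
    calc ∫⁻ ζ in Ioi (0 : ℝ), ENNReal.ofReal (Real.pi⁻¹ * Real.exp (r ζ * t))
        ≤ ∫⁻ ζ in Ioi (0 : ℝ), ENNReal.ofReal (Real.exp (γ * t))
            * ENNReal.ofReal (Real.pi⁻¹ * (1 + b * ζ ^ 2)⁻¹) := by
          refine lintegral_mono fun ζ => ?_
          rw [← ENNReal.ofReal_mul (Real.exp_pos _).le]
          exact ENNReal.ofReal_le_ofReal (hle ζ)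
      _ = ENNReal.ofReal (Real.exp (γ * t) * (2 * √b)⁻¹) := by
          rw [lintegral_const_mul' _ _ ENNReal.ofReal_ne_top, lintegral_inv_one_add_mul_sq hb0,
            ← ENNReal.ofReal_mul (Real.exp_pos _).le]
      _ = _ := by
          congr 1
          rw [hb, Real.sqrt_div ht0.le]
          have : 0 < √t := Real.sqrt_pos.2 ht0
          have : 0 < √(1 + h * κ) := Real.sqrt_pos.2 hden
          field_simp
  · intro ζ t _
    have := ((hasDerivAt_id t).const_mul (r ζ)).exp
    simpa [mul_comm] using this
  · intro ζ t _
    have e1 : q * Real.exp (r ζ * (t - h)) = κ * (1 + a * ζ ^ 2) * Real.exp (r ζ * t) := by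
      have : Real.exp (r ζ * (t - h))
          = Real.exp (-(h * γ)) * (1 + a * ζ ^ 2) * Real.exp (r ζ * t) := by
        refine Eq.trans ?_ (congrArg (fun y => Real.exp (-(h * γ)) * y * Real.exp (r ζ * t))
          (Real.exp_log (lt_of_lt_of_le one_pos (hbase ζ))))
        rw [← Real.exp_add, ← Real.exp_add]
        congr 1
        simp only [hr]
        field_simp
        ring
      rw [this, hγ]
      ring
    rw [e1, ← sub_mul]
    refine mul_le_mul_of_nonneg_right ?_ (Real.exp_pos _).le
    have e2 : Real.log (1 + a * ζ ^ 2) / h ≤ a / h * ζ ^ 2 := by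
      rw [show a / h * ζ ^ 2 = a * ζ ^ 2 / h by ring]
      exact div_le_div_of_nonneg_right (hlog1 ζ) hh.le
    simp only [hr]
    have e3 : (a * κ + a / h) * ζ ^ 2 = ζ ^ 2 := by rw [haκ, one_mul]
    linarith

/-- For `0 < t ≤ h` the delayed term only sees the initial data, and a direct supersolution is
used. -/
theorem enorm_le_of_time_le {h m p q d γ M : ℝ} (hh : 0 < h) (hq : 0 < q) (hγ0 : γ ≤ 0)
    (hγ : γ - p = q * Real.exp (-(h * γ))) {w F : ℝ → ℝ → ℝ}
    (hwc : Continuous (Function.uncurry w))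
    (hw : SatisfiesDuhamel m p w F)
    (hF : ∀ t, 0 ≤ t → ∀ z, |F t z| ≤ q * |w (t - h) (z + d)|)
    (hL1 : ∀ t ∈ Icc (-h) 0, ∫⁻ z, ‖w t z‖ₑ ≤ ENNReal.ofReal M) {t : ℝ} (ht0 : 0 < t)
    (ht : t ≤ h) (x : ℝ) :
    ‖w t x‖ₑ ≤ ENNReal.ofReal M * ENNReal.ofReal
      (√(1 + h * (γ - p)) / 2 * (Real.exp (γ * t) / √t)) := by
  have hκ : 0 < γ - p := by rw [hγ]; positivity
  have hpi := Real.pi_pos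
  set κ := γ - p with hκd
  have hpκ : p = γ - κ := by rw [hκd]; ring
  set g : ℝ → ℝ → ℝ := fun ζ t => Real.exp ((p - ζ ^ 2) * t) + κ / (ζ ^ 2 + κ) * Real.exp (γ * t)
    with hg
  have hgc : Continuous (Function.uncurry g) := by
    refine Continuous.add (by fun_prop) (Continuous.mul (Continuous.div (by fun_prop)
      (by fun_prop) fun r => ?_) (by fun_prop))
    positivity
  have hgt : ∀ ζ, Continuous (g ζ) := fun ζ =>
    hgc.comp (by fun_prop : Continuous fun t : ℝ => (ζ, t))
  have hpos : ∀ ζ t, 0 ≤ g ζ t := fun ζ t => by simp only [hg]; positivity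
  have hg0 : ∀ ζ, 1 ≤ g ζ 0 := fun ζ => by
    simp only [hg, mul_zero, Real.exp_zero, mul_one]
    exact le_add_of_nonneg_right (by positivity)
  set β : ℝ → ℝ → ℝ := fun ζ t => if t < 0 then 1 else g ζ t with hβ
  have hβneg : ∀ ζ t, t < 0 → β ζ t = 1 := fun ζ t ht => by simp [hβ, ht]
  have hβpos : ∀ ζ t, 0 ≤ t → β ζ t = g ζ t := fun ζ t ht => by simp [hβ, ht]
  have key := enorm_le_of_frequency_supersolution hh hq.le hwc hw hF hL1 (T := h)
    (β := β) (D := fun ζ t => (p - ζ ^ 2) * Real.exp ((p - ζ ^ 2) * t)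
      + κ / (ζ ^ 2 + κ) * (γ * Real.exp (γ * t))) ?_ ?_ ?_ ?_ ?_ ?_ ?_ (t := t) ⟨ht0, ht⟩ x
  · refine key.trans (mul_le_mul' le_rfl ?_)
    have hκinv : ∀ ζ : ℝ, κ / (ζ ^ 2 + κ) = (1 + κ⁻¹ * ζ ^ 2)⁻¹ := fun ζ => by
      field_simp
      ring
    calc ∫⁻ ζ in Ioi (0 : ℝ), ENNReal.ofReal (Real.pi⁻¹ * β ζ t)
        = ∫⁻ ζ in Ioi (0 : ℝ), (ENNReal.ofReal (Real.exp (p * t))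
              * ENNReal.ofReal (Real.pi⁻¹ * Real.exp (-(ζ ^ 2 * t)))
            + ENNReal.ofReal (Real.exp (γ * t))
              * ENNReal.ofReal (Real.pi⁻¹ * (1 + κ⁻¹ * ζ ^ 2)⁻¹)) := by
          refine lintegral_congr fun ζ => ?_
          rw [hβpos ζ t ht0.le, ← ENNReal.ofReal_mul (Real.exp_pos _).le,
            ← ENNReal.ofReal_mul (Real.exp_pos _).le,
            ← ENNReal.ofReal_add (by positivity) (by positivity)]
          congr 1
          have e1 : Real.exp ((p - ζ ^ 2) * t)
              = Real.exp (p * t) * Real.exp (-(ζ ^ 2 * t)) := by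
            rw [← Real.exp_add]
            congr 1
            ring
          simp only [hg, e1, hκinv]
          ring
      _ = ENNReal.ofReal (Real.exp (p * t) * (√(4 * Real.pi * t))⁻¹
            + Real.exp (γ * t) * (2 * √κ⁻¹)⁻¹) := by
          rw [lintegral_add_left (by fun_prop), lintegral_const_mul' _ _ ENNReal.ofReal_ne_top,
            lintegral_const_mul' _ _ ENNReal.ofReal_ne_top, lintegral_exp_neg_sq_mul ht0,
            lintegral_inv_one_add_mul_sq (inv_pos.2 hκ),
            ← ENNReal.ofReal_mul (Real.exp_pos _).le, ← ENNReal.ofReal_mul (Real.exp_pos _).le,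
            ← ENNReal.ofReal_add (by positivity) (by positivity)]
      _ ≤ _ := by
          refine ENNReal.ofReal_le_ofReal ?_
          have hst : 0 < √t := Real.sqrt_pos.2 ht0
          have hsp : 0 < √Real.pi := Real.sqrt_pos.2 hpi
          have hsk : 0 < √κ := Real.sqrt_pos.2 hκ
          have e1 : √(4 * Real.pi * t) = 2 * √Real.pi * √t := by
            rw [Real.sqrt_mul (by positivity), Real.sqrt_mul (by positivity),
              show (4 : ℝ) = 2 ^ 2 by norm_num, Real.sqrt_sq (by norm_num)]
          have e2 : Real.exp (p * t) = Real.exp (γ * t) * Real.exp (-(κ * t)) := by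
            rw [hpκ, ← Real.exp_add]
            congr 1
            ring
          have e3 := exp_neg_div_sqrt_pi_add_sqrt_le (mul_nonneg hκ.le ht0.le)
          have e4 : √(1 + κ * t) ≤ √(1 + h * κ) := by
            apply Real.sqrt_le_sqrt
            nlinarith
          rw [Real.sqrt_mul hκ.le] at e3
          rw [e1, e2, Real.sqrt_inv]
          calc Real.exp (γ * t) * Real.exp (-(κ * t)) * (2 * √Real.pi * √t)⁻¹
                + Real.exp (γ * t) * (2 * (√κ)⁻¹)⁻¹
              = Real.exp (γ * t) / (2 * √t)
                * (Real.exp (-(κ * t)) / √Real.pi + √κ * √t) := by field_simp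
            _ ≤ Real.exp (γ * t) / (2 * √t) * √(1 + h * κ) :=
                mul_le_mul_of_nonneg_left (e3.trans e4) (by positivity)
            _ = _ := by field_simp
  · refine Measurable.ite ?_ measurable_const hgc.measurable
    exact measurableSet_lt measurable_snd measurable_const
  · intro ζ t
    rcases lt_or_ge t 0 with h1 | h1
    · rw [hβneg ζ t h1]; exact zero_le_one
    · rw [hβpos ζ t h1]; exact hpos ζ t
  · intro ζ t ht
    rcases ht.2.lt_or_eq with h1 | rfl
    · rw [hβneg ζ t h1]
    · rw [hβpos ζ 0 le_rfl]; exact hg0 ζ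
  · intro ζ
    rw [integrableOn_Icc_iff_integrableOn_Ico]
    refine IntegrableOn.congr_fun (f := fun _ => (1 : ℝ))
      (integrableOn_const (by simp)) (fun t ht => ?_) measurableSet_Ico
    rw [hβneg ζ _ (by linarith [ht.2])]
  · intro ζ
    exact (hgt ζ).continuousOn.congr fun t ht => hβpos ζ t ht.1
  · intro ζ t ht
    have hev : β ζ =ᶠ[𝓝 t] g ζ := by
      filter_upwards [Ioi_mem_nhds ht.1] with s hs using hβpos ζ s (le_of_lt hs)
    refine HasDerivAt.congr_of_eventuallyEq ?_ hev
    have h1 := ((hasDerivAt_id t).const_mul (p - ζ ^ 2)).exp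
    have h2 := (((hasDerivAt_id t).const_mul γ).exp).const_mul (κ / (ζ ^ 2 + κ))
    refine (h1.add h2).congr_deriv ?_
    simp only [id, mul_one]
    ring
  · intro ζ t ht
    rw [hβneg ζ _ (by linarith [ht.2]), hβpos ζ t ht.1.le]
    have e1 : q ≤ κ * Real.exp (γ * t) := by
      rw [hγ, mul_assoc, ← Real.exp_add]
      refine le_mul_of_one_le_right hq.le (Real.one_le_exp ?_)
      nlinarith [ht.2]
    have e2 : κ / (ζ ^ 2 + κ) * (ζ ^ 2 + κ) = κ := div_mul_cancel₀ _ (by positivity)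
    have e3 : (p - ζ ^ 2) * Real.exp ((p - ζ ^ 2) * t) + κ / (ζ ^ 2 + κ) * (γ * Real.exp (γ * t))
        - (p - ζ ^ 2) * g ζ t = κ * Real.exp (γ * t) := by
      simp only [hg, hpκ]
      linear_combination Real.exp (γ * t) * e2
    rw [e3, mul_one]
    exact e1

/-! ### The characteristic function -/

theorem continuous_charE (h L : ℝ) : Continuous fun y : ℝ × ℝ => charE h L y.1 y.2 := by
  unfold charE
  fun_prop

theorem pos_of_charE_nonneg {h L c x : ℝ} (hh : 0 < h) (hL : 1 < L) (hc : 0 ≤ c)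
    (hx : 0 ≤ charE h L c x) : 0 < x := by
  by_contra hcon
  have hx0 : x ≤ 0 := not_lt.1 hcon
  have h1 : 1 ≤ Real.exp (-(x * c * h)) := Real.one_le_exp (by
    have := mul_nonneg (mul_nonneg (neg_nonneg.2 hx0) hc) hh.le
    linarith)
  have h2 : c * x ≤ 0 := mul_nonpos_of_nonneg_of_nonpos hc hx0
  rw [charE] at hx
  nlinarith [sq_nonneg x]

theorem le_of_charE_nonneg {h L c x : ℝ} (hL : 1 < L) (hc : 0 ≤ c)
    (hx : 0 ≤ charE h L c x) : x ≤ c + 1 := by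
  by_contra hcon
  have hx1 : c + 1 < x := not_le.1 hcon
  have h1 := Real.exp_pos (-(x * c * h))
  rw [charE] at hx
  nlinarith [mul_pos (by linarith : 0 < L) h1]

theorem speed_pos_of_charE_nonneg {h L c x : ℝ} (hL : 1 < L) (hc : 0 ≤ c)
    (hx : 0 ≤ charE h L c x) : 0 < c := by
  refine hc.lt_of_ne fun h0 => ?_
  rw [charE, ← h0] at hx
  simp only [zero_mul, mul_zero, neg_zero, Real.exp_zero] at hx
  nlinarith [sq_nonneg x]

/-- The infimum that defines the critical speed is attained: the admissible `x` stay in a compact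
set that depends continuously on the speed. -/
theorem criticalSpeed_mem {h L : ℝ} (hh : 0 < h) (hL : 1 < L) :
    criticalSpeed h L ∈ {c : ℝ | 0 < c ∧ ∃ x : ℝ, 0 ≤ charE h L c x} := by
  refine IsClosed.csInf_mem ?_ ⟨L, one_pos.trans hL, 1, ?_⟩ ⟨0, fun c hc => hc.1.le⟩
  · have himg : {c : ℝ | 0 < c ∧ ∃ x : ℝ, 0 ≤ charE h L c x}
        = Prod.snd '' ({y : Icc (0 : ℝ) 1 × ℝ | 0 ≤ y.2} ∩
          {y | 0 ≤ charE h L y.2 ((y.2 + 1) * (y.1 : ℝ))}) := by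
      ext c
      constructor
      · rintro ⟨hc, x, hx⟩
        have h1 : 0 < c + 1 := by linarith
        refine ⟨(⟨x / (c + 1), ?_, ?_⟩, c), ⟨hc.le, ?_⟩, rfl⟩
        · exact div_nonneg (pos_of_charE_nonneg hh hL hc.le hx).le h1.le
        · exact (div_le_one h1).2 (le_of_charE_nonneg hL hc.le hx)
        · change 0 ≤ charE h L c ((c + 1) * (x / (c + 1)))
          rwa [mul_div_cancel₀ x h1.ne']
      · rintro ⟨y, ⟨h1, h2⟩, rfl⟩
        exact ⟨speed_pos_of_charE_nonneg hL h1 h2, _, h2⟩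
    rw [himg]
    refine isClosedMap_snd_of_compactSpace _ (IsClosed.inter
      (isClosed_le continuous_const continuous_snd) (isClosed_le continuous_const ?_))
    exact (continuous_charE h L).comp (by fun_prop : Continuous fun y : Icc (0 : ℝ) 1 × ℝ =>
      (y.2, (y.2 + 1) * (y.1 : ℝ)))
  · have h1 : Real.exp (-(1 * L * h)) ≤ 1 := Real.exp_le_one_iff.2 (by nlinarith)
    rw [charE]
    nlinarith

theorem concaveOn_charE {h L c : ℝ} (hL : 0 ≤ L) : ConcaveOn ℝ univ (charE h L c) := by
  refine ⟨convex_univ, fun x _ y _ a b ha hb hab => ?_⟩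
  have h1 := convexOn_exp.2 (mem_univ (-(x * c * h))) (mem_univ (-(y * c * h))) ha hb hab
  simp only [smul_eq_mul] at h1 ⊢
  have h2 : a * -(x * c * h) + b * -(y * c * h) = -((a * x + b * y) * c * h) := by ring
  rw [h2] at h1
  have h3 : (a * x + b * y) ^ 2 ≤ a * x ^ 2 + b * y ^ 2 := by
    have hb' : b = 1 - a := by linarith
    subst hb'
    nlinarith [mul_nonneg (mul_nonneg ha hb) (sq_nonneg (x - y))]
  have h4 := mul_le_mul_of_nonneg_left h1 hL
  simp only [charE]
  linear_combination h3 + h4 + (1 : ℝ) * hab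

/-- Speeds beyond the critical one are positive, and the characteristic function is nonnegative
between its zeros. -/
theorem charE_nonneg_of_mem_Icc {h L c lam : ℝ} (hh : 0 < h) (hL : 1 < L)
    (hc : criticalSpeed h L ≤ c) (hlam : lam ∈ Icc (lambdaOne h L c) (lambdaTwo h L c)) :
    0 < c ∧ 0 ≤ charE h L c lam := by
  obtain ⟨hc0, x₀, hx₀⟩ := criticalSpeed_mem hh hL
  have hcpos : 0 < c := hc0.trans_le hc
  have hx₀pos := pos_of_charE_nonneg hh hL hc0.le hx₀
  have hx₀c : 0 ≤ charE h L c x₀ := by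
    refine hx₀.trans ?_
    simp only [charE]
    have h1 : criticalSpeed h L * x₀ ≤ c * x₀ := mul_le_mul_of_nonneg_right hc hx₀pos.le
    have h2 : Real.exp (-(x₀ * c * h)) ≤ Real.exp (-(x₀ * criticalSpeed h L * h)) := by
      apply Real.exp_le_exp.2
      nlinarith [mul_le_mul_of_nonneg_right h1 hh.le]
    nlinarith
  have hcont : Continuous (charE h L c) :=
    (continuous_charE h L).comp (by fun_prop : Continuous fun x : ℝ => (c, x))
  set Z := {x : ℝ | charE h L c x = 0} with hZ
  have hZc : IsClosed Z := isClosed_eq hcont continuous_const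
  have hZsub : Z ⊆ Icc 0 (c + 1) := fun x hx =>
    ⟨(pos_of_charE_nonneg hh hL hcpos.le (le_of_eq (Eq.symm hx))).le,
      le_of_charE_nonneg hL hcpos.le (le_of_eq (Eq.symm hx))⟩
  have hZne : Z.Nonempty := by
    have h0 : charE h L c 0 ≤ 0 := by
      simp only [charE, zero_mul, neg_zero, Real.exp_zero]
      linarith
    obtain ⟨x, -, hx⟩ := intermediate_value_Icc hx₀pos.le hcont.continuousOn ⟨h0, hx₀c⟩
    exact ⟨x, hx⟩
  have hinf : charE h L c (lambdaOne h L c) = 0 :=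
    hZc.csInf_mem hZne (bddBelow_Icc.mono hZsub)
  have hsup : charE h L c (lambdaTwo h L c) = 0 :=
    hZc.csSup_mem hZne (bddAbove_Icc.mono hZsub)
  refine ⟨hcpos, ?_⟩
  have := (concaveOn_charE (h := h) (c := c) (by linarith : 0 ≤ L)).min_le_of_mem_Icc
    (mem_univ _) (mem_univ _) hlam
  rwa [hinf, hsup, min_self] at this

/-- The characteristic equation of the delay equation has exactly one real root, which is
nonpositive. -/
theorem exists_unique_decay_rate {h p q : ℝ} (hh : 0 < h) (hq : 0 < q) (hpq : p + q ≤ 0) :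
    ∃ γ : ℝ, γ ≤ 0 ∧ γ - p = q * Real.exp (-(h * γ)) ∧
      ∀ γ' : ℝ, γ' - p = q * Real.exp (-(h * γ')) → γ' = γ := by
  have hmono : StrictMono fun γ : ℝ => γ - p - q * Real.exp (-(h * γ)) := by
    intro x y hxy
    have h1 : Real.exp (-(h * y)) < Real.exp (-(h * x)) := Real.exp_lt_exp.2 (by nlinarith)
    simp only []
    nlinarith
  have hp : p ≤ 0 := by linarith
  have hcont : Continuous fun γ : ℝ => γ - p - q * Real.exp (-(h * γ)) := by fun_prop
  obtain ⟨γ, hγ, hγ0⟩ := intermediate_value_Icc hp hcont.continuousOn (show (0 : ℝ) ∈ _ from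
    ⟨by
      have := mul_pos hq (Real.exp_pos (-(h * p)))
      simp only [sub_self]; linarith, by
      simp only [mul_zero, neg_zero, Real.exp_zero]; linarith⟩)
  refine ⟨γ, hγ.2, by linarith [hγ0], fun γ' hγ' => hmono.injective ?_⟩
  simp only [] at hγ0 ⊢
  linarith

/-! ### Stability of the leading edge -/

theorem weight_pos (lam z : ℝ) : 0 < weight lam z := Real.exp_pos _

/-- The weighted difference of two solutions is a mild solution of the conjugated equation, and
its source is dominated by the delayed value. -/
theorem IsWaveSolution.exists_duhamel_weight {h c : ℝ} (hh : 0 < h) {g : ℝ → ℝ} {L : ℝ≥0}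
    (hgL : LipschitzOnWith L g (Ici 0)) (lam : ℝ) {v ψ : ℝ → ℝ → ℝ}
    (hv : IsWaveSolution h c g v) (hψ : IsWaveSolution h c g ψ)
    (hgrowth : HasGaussianGrowth h (fun t z => v t z - ψ t z)) :
    ∃ W Φ : ℝ → ℝ → ℝ, Continuous (Function.uncurry W) ∧
      (∀ t, -h ≤ t → ∀ z, |W t z| = weightedDiff lam v ψ t z) ∧
      SatisfiesDuhamel (coefM c lam) (coefP c lam) W Φ ∧
      ∀ t, 0 ≤ t → ∀ z, |Φ t z| ≤ coefQ h L c lam * |W (t - h) (z + -(c * h))| := by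
  set v' := extendTime h v with hv'
  set ψ' := extendTime h ψ with hψ'
  have hv'c : Continuous (Function.uncurry v') := continuous_extendTime hv.solves.continuousOn
  have hψ'c : Continuous (Function.uncurry ψ') := continuous_extendTime hψ.solves.continuousOn
  have hv'0 : ∀ t z, v' t z ∈ Ici (0 : ℝ) := fun t z => hv.nonneg _ (le_max_right _ _) z
  have hψ'0 : ∀ t z, ψ' t z ∈ Ici (0 : ℝ) := fun t z => hψ.nonneg _ (le_max_right _ _) z
  have hshift : ∀ f : ℝ → ℝ → ℝ, Continuous (Function.uncurry f) →
      (∀ t z, f t z ∈ Ici (0 : ℝ)) →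
      Continuous (Function.uncurry fun t z => g (f (t - h) (z + -(c * h)))) := fun f hf hf0 =>
    hgL.continuousOn.comp_continuous (hf.comp (by fun_prop : Continuous fun y : ℝ × ℝ =>
      (y.1 - h, y.2 + -(c * h)))) fun y => hf0 _ _
  have hFv := hshift v' hv'c hv'0
  have hFψ := hshift ψ' hψ'c hψ'0
  set w : ℝ → ℝ → ℝ := fun t z => v' t z - ψ' t z with hw
  set F : ℝ → ℝ → ℝ := fun t z => g (v' (t - h) (z + -(c * h))) - g (ψ' (t - h) (z + -(c * h)))
    with hF
  have hcut : HasCutoffIdentity (-c) (-1) w F :=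
    ((hv.solves.isWeakSolution hh).hasCutoffIdentity hv'c hFv).sub
      ((hψ.solves.isWeakSolution hh).hasCutoffIdentity hψ'c hFψ) hv'c hFv hψ'c hFψ
  have hwc : Continuous (Function.uncurry w) := hv'c.sub hψ'c
  have hwv : ∀ t, -h ≤ t → ∀ z, w t z = v t z - ψ t z := fun t ht z => by
    simp only [hw, hv', hψ', extendTime_of_le ht]
  have hwg : HasGaussianGrowth h w := fun T => by
    obtain ⟨C, a, hC⟩ := hgrowth T
    exact ⟨C, a, fun t ht z => by rw [hwv t ht.1]; exact hC t ht z⟩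
  have hFw : ∀ t z, |F t z| ≤ L * |w (t - h) (z + -(c * h))| := fun t z => by
    have := hgL.dist_le_mul _ (hv'0 (t - h) (z + -(c * h))) _ (hψ'0 (t - h) (z + -(c * h)))
    simpa only [Real.dist_eq] using this
  have hmild := hcut.isMildSolution hh.le hwc (hFv.sub hFψ) hwg fun t _ z => hFw t z
  refine ⟨fun t z => weight lam z * w t z, fun t z => weight lam z * F t z, ?_, ?_, ?_, ?_⟩
  · refine Continuous.mul ?_ hwc
    simp only [weight]
    fun_prop
  · intro t ht z
    rw [abs_mul, hwv t ht, weightedDiff, abs_of_pos (weight_pos lam z)]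
  · intro T
    obtain ⟨ε, hε, H⟩ := hmild T
    refine ⟨ε, hε, fun a b x ha hab hbT hbε => ?_⟩
    beta_reduce
    rw [(H a b x ha hab hbT hbε).2.2.2, mul_add, weight_mul_heatOp c lam x (sub_nonneg.2 hab),
      ← intervalIntegral.integral_const_mul]
    congr 1
    refine intervalIntegral.integral_congr fun t ht => ?_
    rw [uIcc_of_le hab] at ht
    exact weight_mul_heatOp c lam x (sub_nonneg.2 ht.2) _
  · intro t _ z
    have e1 : weight lam z = Real.exp (-(lam * c * h)) * weight lam (z + -(c * h)) := by
      rw [weight, weight, ← Real.exp_add]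
      congr 1
      ring
    have e0 := weight_pos lam z
    have e2 := weight_pos lam (z + -(c * h))
    rw [abs_mul, abs_mul, abs_of_pos e0, abs_of_pos e2, coefQ]
    calc weight lam z * |F t z| ≤ weight lam z * (L * |w (t - h) (z + -(c * h))|) :=
          mul_le_mul_of_nonneg_left (hFw t z) e0.le
      _ = _ := by rw [e1]; ring

theorem supL1_nonneg (h : ℝ) (f : ℝ → ℝ → ℝ) : 0 ≤ supL1 h f :=
  Real.iSup_nonneg fun _ => integral_nonneg fun _ => abs_nonneg _

/-- For data in `C([-h, 0], L¹)` the supremum in `supL1` is a genuine bound on the `L¹` norms. -/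
theorem MemCL1.lintegral_le {h : ℝ} {f : ℝ → ℝ → ℝ} (hf : MemCL1 h f) {s : ℝ}
    (hs : s ∈ Icc (-h) 0) : ∫⁻ z, ‖f s z‖ₑ ≤ ENNReal.ofReal (supL1 h f) := by
  obtain ⟨U, hU⟩ := hf
  have hnorm : ∀ r : Icc (-h) 0, ∫ z, |f r z| = ‖U r‖ := fun r => by
    rw [L1.norm_eq_integral_norm]
    refine integral_congr_ae ?_
    filter_upwards [hU r] with z hz
    rw [hz, Real.norm_eq_abs]
  have hbdd : BddAbove (range fun r : Icc (-h) 0 => ∫ z, |f r z|) := by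
    refine ⟨‖U‖, ?_⟩
    rintro _ ⟨r, rfl⟩
    simp only [hnorm r]
    exact U.norm_coe_le_norm r
  have hint : Integrable (f s) := (L1.integrable_coeFn (U ⟨s, hs⟩)).congr (hU ⟨s, hs⟩)
  rw [← ofReal_integral_norm_eq_lintegral_enorm hint]
  exact ENNReal.ofReal_le_ofReal (le_ciSup hbdd ⟨s, hs⟩)

theorem mainTheorem3
    (h : ℝ) (hh : 0 < h)
    (g : ℝ → ℝ) (hg : MapsTo g (Ici 0) (Ici 0))
    (L : ℝ≥0) (hL : 1 < L) (hgL : LipschitzOnWith L g (Ici 0))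
    (c : ℝ) (hc : criticalSpeed h L ≤ c)
    (lam : ℝ) (hlam : lam ∈ Icc (lambdaOne h L c) (lambdaTwo h L c))
    (v ψ : ℝ → ℝ → ℝ)
    (hv : IsWaveSolution h c g v) (hψ : IsWaveSolution h c g ψ)
    (hgrowth : HasGaussianGrowth h (fun t z => v t z - ψ t z))
    (hu₀ : MemCL1 h (weightedDiff lam v ψ)) :
    (∀ u : ℝ → ℝ → ℝ,
      IsLinearSolution h (coefM c lam) (coefP c lam) (coefQ h L c lam) (-(c * h)) u →
      HasGaussianGrowth h u →
      (∀ s ∈ Icc (-h) 0, ∀ z, u s z = weightedDiff lam v ψ s z) →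
      ∀ t, -h ≤ t → ∀ z, weight lam z * |v t z - ψ t z| ≤ u t z) ∧
    (∃ γ : ℝ, γ ≤ 0 ∧
      γ - coefP c lam = coefQ h L c lam * Real.exp (-(h * γ)) ∧
      (∀ γ' : ℝ, γ' - coefP c lam = coefQ h L c lam * Real.exp (-(h * γ')) → γ' = γ) ∧
      ∀ t, h / 2 < t → ∀ z,
        |v t z - ψ t z| ≤
          (supL1 h (weightedDiff lam v ψ) / 2 * Real.sqrt (1 + h * (γ - coefP c lam)))
            * weight lam (-z) * (Real.exp (γ * t) / Real.sqrt t)) ∧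
    (∀ N : ℝ, TendstoUniformlyOn (fun t z => v t z - ψ t z) (fun _ => 0) atTop (Iic N)) := by
  have hL' : (1 : ℝ) < L := by exact_mod_cast hL
  obtain ⟨hcpos, hE⟩ := charE_nonneg_of_mem_Icc hh hL' hc hlam
  have hlam0 : 0 < lam := pos_of_charE_nonneg hh hL' hcpos.le hE
  have hq : 0 < coefQ h L c lam := by
    have : (0 : ℝ) < L := by linarith
    rw [coefQ]
    positivity
  have hpq : coefP c lam + coefQ h L c lam ≤ 0 := by
    rw [charE] at hE
    rw [coefP, coefQ]
    linarith
  obtain ⟨W, Φ, hWc, hWabs, hW, hΦ⟩ := hv.exists_duhamel_weight hh hgL lam hψ hgrowth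
  obtain ⟨γ, hγ0, hγ, hγu⟩ := exists_unique_decay_rate hh hq hpq
  set M := supL1 h (weightedDiff lam v ψ) with hM
  have hM0 : 0 ≤ M := supL1_nonneg _ _
  have hL1 : ∀ t ∈ Icc (-h) 0, ∫⁻ z, ‖W t z‖ₑ ≤ ENNReal.ofReal M := fun t ht => by
    refine le_trans (le_of_eq (lintegral_congr fun z => ?_)) (hu₀.lintegral_le ht)
    rw [← hWabs t ht.1 z, Real.enorm_eq_ofReal_abs, Real.enorm_eq_ofReal_abs, abs_abs]
  have hdecay : ∀ t, 0 < t → ∀ z, |v t z - ψ t z| ≤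
      (M / 2 * Real.sqrt (1 + h * (γ - coefP c lam))) * weight lam (-z)
        * (Real.exp (γ * t) / Real.sqrt t) := by
    intro t ht z
    have hb : ‖W t z‖ₑ ≤ ENNReal.ofReal M * ENNReal.ofReal
        (√(1 + h * (γ - coefP c lam)) / 2 * (Real.exp (γ * t) / √t)) := by
      rcases le_total t h with h1 | h1
      · exact enorm_le_of_time_le hh hq hγ0 hγ hWc hW hΦ hL1 ht h1 z
      · exact enorm_le_of_le_time hh hq hγ0 hγ hWc hW hΦ hL1 h1 z
    rw [← ENNReal.ofReal_mul hM0, Real.enorm_eq_ofReal_abs,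
      ENNReal.ofReal_le_ofReal_iff (by positivity), hWabs t (by linarith) z, weightedDiff] at hb
    have e1 : weight lam (-z) * weight lam z = 1 := by
      rw [weight, weight, ← Real.exp_add]
      simp
    have e2 := weight_pos lam (-z)
    calc |v t z - ψ t z| = weight lam (-z) * (weight lam z * |v t z - ψ t z|) := by
          rw [← mul_assoc, e1, one_mul]
      _ ≤ _ := mul_le_mul_of_nonneg_left hb e2.le
      _ = _ := by ring
  refine ⟨?_, ⟨γ, hγ0, hγ, hγu, fun t ht z => hdecay t (by linarith) z⟩, ?_⟩
  · intro u hu hug hu0 t ht z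
    have hu'c : Continuous (Function.uncurry (extendTime h u)) :=
      continuous_extendTime hu.continuousOn
    have hFc : Continuous (Function.uncurry fun t z =>
        coefQ h L c lam * extendTime h u (t - h) (z + -(c * h))) :=
      continuous_const.mul (hu'c.comp (by fun_prop : Continuous fun y : ℝ × ℝ =>
        (y.1 - h, y.2 + -(c * h))))
    have hu'g : HasGaussianGrowth h (extendTime h u) := fun T => by
      obtain ⟨C, a, hC⟩ := hug T
      exact ⟨C, a, fun t ht z => by rw [extendTime_of_le ht.1]; exact hC t ht z⟩
    have hmild := ((IsDelayedSolution.isWeakSolution hh hu).hasCutoffIdentity hu'c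
      hFc).isMildSolution (Λ := coefQ h L c lam) hh.le hu'c hFc hu'g
        fun t _ z => by rw [abs_mul, abs_of_pos hq]
    have := IsMildSolution.abs_le hh hq.le hW hΦ hmild (fun t ht z => by
      rw [hWabs t ht.1, extendTime_of_le ht.1, hu0 t ht]) ht z
    rwa [hWabs t ht, extendTime_of_le ht] at this
  · intro N
    set A := M / 2 * Real.sqrt (1 + h * (γ - coefP c lam)) * weight lam (-N) with hA
    have hlim : Tendsto (fun t : ℝ => A / √t) atTop (𝓝 0) :=
      tendsto_const_nhds.div_atTop Real.tendsto_sqrt_atTop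
    rw [Metric.tendstoUniformlyOn_iff]
    intro ε hε
    filter_upwards [hlim.eventually_lt_const hε, eventually_gt_atTop 0] with t ht ht0 z hz
    rw [dist_comm, Real.dist_eq, sub_zero]
    refine (hdecay t ht0 z).trans_lt (lt_of_le_of_lt ?_ ht)
    have e1 : weight lam (-z) ≤ weight lam (-N) := by
      apply Real.exp_le_exp.2
      have : lam * z ≤ lam * N := mul_le_mul_of_nonneg_left hz hlam0.le
      linarith
    have e2 : Real.exp (γ * t) ≤ 1 :=
      Real.exp_le_one_iff.2 (mul_nonpos_of_nonpos_of_nonneg hγ0 ht0.le)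
    have e3 := weight_pos lam (-z)
    have e4 := weight_pos lam (-N)
    calc _ ≤ M / 2 * Real.sqrt (1 + h * (γ - coefP c lam)) * weight lam (-N) * (1 / √t) := by
          gcongr
      _ = A / √t := by rw [hA]; ring
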